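/- Let $n$ be a dimension, $D>0$, $\lambda>0$, and let $(p_i)_{i\ge 0}$ be a probability distribution with finite mean $B=\sum_i i\,p_i$. Consider the branching diffusion in $\mathbb R^n$ generated by a single immigrant (generation $0$) injected at time $0$ at the point $\mathbf y$: each particle lives for an exponential time with rate $\lambda$ and then splits, at its current location, into $i$ particles of the next generation with probability $p_i$; during its life it performs a Brownian motion with diffusion constant $D$, i.e. a particle born at $\mathbf y$ at time $0$ has at age $t$ the density $p(\mathbf x,\mathbf y,t)=(4\pi Dt)^{-n/2}\exp\{-|\mathbf x-\mathbf y|^2/(4Dt)\}$; lifetimes, numbers of offspring and motions of all particles are independent. For measurable $G\subset\mathbb R^n$, $k\ge 0$ and $t\ge 0$ let $\bar A_k(G,\mathbf y,t)$ be the expected number of generation-$k$ particles in $G$ at time $t$. Then $\bar A_k(G,\mathbf y,t)$ is finite and equals $\frac{\partial}{\partial s}M_k(G,\mathbf y,t;s)\big|_{s=0}$, where $M_k(G,\mathbf y,t;s)=\sum_i p_{k,i}(G,\mathbf y,t)e^{si}$, $p_{k,i}(G,\mathbf y,t)$ is the probability of having exactly $i$ generation-$k$ particles in $G$ at time $t$,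 and the derivative is taken within the set of all $s$ for which the series converges (which contains $(-\infty,0]$). At time $0$, $\bar A_0(\cdot,\mathbf y,0)=\delta_{\mathbf y}$. Except for $k=0$, $t=0$, there are nonnegative first moment densities $A_k(\mathbf x,\mathbf y,t)$, unique up to null sets of $\mathbf x$, with $\bar A_k(G,\mathbf y,t)=\int_G A_k(\mathbf x,\mathbf y,t)\,d\mathbf x$ for all measurable $G$; a version of them solves the recursive system $$\frac{\partial A_k}{\partial t}=D\Delta_{\mathbf x}A_k-\lambda A_k+\lambda B A_{k-1},\qquad k\ge 1,\ t>0,$$ with $A_k(\mathbf x,\mathbf y,0)=0$ for $k\ge1$, $A_0(\mathbf x,\mathbf y,0)=\delta(\mathbf y-\mathbf x)$, and $A_0(\mathbf x,\mathbf y,t)=e^{-\lambda t}p(\mathbf x,\mathbf y,t)$ for $t>0$, where the initial conditions also hold as weak limits $t\downarrow 0$ against bounded continuous functions of $\mathbf x$. This solution is unique among the solutions of the system for which every $A_k(\cdot,\mathbf y,\cdot)$, $k\ge1$, is twice continuously differentiable on $\mathbb R^n\times(0,\infty)$ and bounded in $L^1(\mathbb R^n)$ on bounded time intervals, and for $t>0$,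 $k\ge 0$ it is given by $$A_k(\mathbf x,\mathbf y,t)=\frac{(\lambda Bt)^k}{k!}A_0(\mathbf x,\mathbf y,t)=\frac{(\lambda B)^k}{k!\,(4\pi D)^{n/2}}\,t^{k-n/2}\exp\Big\{-\lambda t-\frac{|\mathbf x-\mathbf y|^2}{4Dt}\Big\}.$$ -/

import Mathlib

open MeasureTheory ProbabilityTheory Filter Topology
open scoped NNReal ENNReal BoundedContinuousFunction

noncomputable section

/-- The density at `x`, at time `t > 0`, of a particle that starts at `y` at time `0` and diffuses
in `ℝⁿ` with diffusion constant `D`, i.e. the fundamental solution of `∂ₜ p = D Δₓ p`. -/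
def diffusionDensity {n : ℕ} (D : ℝ) (x y : EuclideanSpace ℝ (Fin n)) (t : ℝ) : ℝ :=
  (4 * Real.pi * D * t) ^ (-(n : ℝ) / 2) * Real.exp (-‖x - y‖ ^ 2 / (4 * D * t))

/-- `W` is a Brownian motion in `ℝⁿ` with diffusion constant `D`, started at the origin:
continuous paths, independent increments, and the displacement between two instants `s < t`
has the diffusion density of duration `t - s`. -/
structure IsDiffusion {n : ℕ} (D : ℝ) {Ω : Type*} [MeasurableSpace Ω] (P : Measure Ω)
    (W : ℝ≥0 → Ω → EuclideanSpace ℝ (Fin n)) : Prop where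
  measurable : ∀ t, Measurable (W t)
  continuous : ∀ ω, Continuous fun t => W t ω
  zero : ∀ ω, W 0 ω = 0
  indep : HasIndepIncrements W P
  law : ∀ s t : ℝ≥0, s < t → P.map (fun ω => W t ω - W s ω) =
    volume.withDensity fun x => ENNReal.ofReal (diffusionDensity D x 0 ((t : ℝ) - s))

/-- The random inputs of the age-dependent branching diffusion generated by a single immigrant.
Potential particles are labelled by words `u : List ℕ` (`[]` is the immigrant, `i :: u` is the
`i`-th child of `u`). Particle `u` has an exponential lifetime with rate `lam`, splits into a random
number of children with law `p`, and moves from its birthplace along its own Brownian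
motion; all these inputs are independent. -/
structure BranchingDiffusion (n : ℕ) (D lam : ℝ) (p : PMF ℕ) {Ω : Type*} [MeasurableSpace Ω]
    (P : Measure Ω) where
  /-- lifetimes -/
  life : List ℕ → Ω → ℝ
  /-- numbers of children -/
  offspring : List ℕ → Ω → ℕ
  /-- displacement of a particle as a function of its age -/
  motion : List ℕ → ℝ≥0 → Ω → EuclideanSpace ℝ (Fin n)
  measurable_life : ∀ u, Measurable (life u)
  measurable_offspring : ∀ u, Measurable (offspring u)
  law_life : ∀ u, P.map (life u) = expMeasure lam
  law_offspring : ∀ u, P.map (offspring u) = p.toMeasure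
  isDiffusion_motion : ∀ u, IsDiffusion D P (motion u)
  /-- distinct particles are independent -/
  indep_particles :
    iIndepFun (fun u ω => (life u ω, offspring u ω, fun t : ℝ≥0 => motion u t ω)) P
  /-- for one particle, the lifetime, the number of children and the motion are independent -/
  indep_life :
    ∀ u, IndepFun (life u) (fun ω => (offspring u ω, fun t : ℝ≥0 => motion u t ω)) P
  indep_offspring : ∀ u, IndepFun (offspring u) (fun ω (t : ℝ≥0) => motion u t ω) P

namespace BranchingDiffusion

variable {n : ℕ} {D lam : ℝ} {p : PMF ℕ} {Ω : Type*} [MeasurableSpace Ω] {P : Measure Ω}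

/-- The particle labelled `u` is really produced (at some time). -/
def Produced (X : BranchingDiffusion n D lam p P) (ω : Ω) : List ℕ → Prop
  | [] => True
  | i :: u => X.Produced ω u ∧ i < X.offspring u ω

/-- The birth instant of `u`: the splitting instant of its parent (`0` for the immigrant). -/
def birth (X : BranchingDiffusion n D lam p P) (ω : Ω) : List ℕ → ℝ
  | [] => 0
  | _ :: u => X.birth ω u + X.life u ω

/-- The birthplace of `u`: the location of its parent at the moment of splitting (`y` for the
immigrant). -/
def birthplace (X : BranchingDiffusion n D lam p P) (y : EuclideanSpace ℝ (Fin n)) (ω : Ω) :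
    List ℕ → EuclideanSpace ℝ (Fin n)
  | [] => y
  | _ :: u => X.birthplace y ω u + X.motion u (X.life u ω).toNNReal ω

/-- The position at time `t` of `u`, meaningful if `u` is alive at time `t`. -/
def position (X : BranchingDiffusion n D lam p P) (y : EuclideanSpace ℝ (Fin n)) (ω : Ω)
    (u : List ℕ) (t : ℝ) : EuclideanSpace ℝ (Fin n) :=
  X.birthplace y ω u + X.motion u (t - X.birth ω u).toNNReal ω

/-- The particle `u` exists at time `t`. -/
def Alive (X : BranchingDiffusion n D lam p P) (ω : Ω) (u : List ℕ) (t : ℝ) : Prop :=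
  X.Produced ω u ∧ X.birth ω u ≤ t ∧ t < X.birth ω u + X.life u ω

/-- The number of generation-`k` particles in the region `G` at time `t`, when the immigrant is
injected at `y` at time `0`. -/
def count (X : BranchingDiffusion n D lam p P) (k : ℕ) (G : Set (EuclideanSpace ℝ (Fin n)))
    (y : EuclideanSpace ℝ (Fin n)) (t : ℝ) (ω : Ω) : ℕ∞ :=
  Set.encard {u : List ℕ | u.length = k ∧ X.Alive ω u t ∧ X.position y ω u t ∈ G}

/-- The probability that there are exactly `i` particles of generation `k` in `G` at time `t`. -/
def countProb (X : BranchingDiffusion n D lam p P) (k i : ℕ)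
    (G : Set (EuclideanSpace ℝ (Fin n))) (y : EuclideanSpace ℝ (Fin n)) (t : ℝ) : ℝ :=
  P.real {ω | X.count k G y t ω = (i : ℕ∞)}

/-- The set of all `s` for which the series defining the moment generating function converges. -/
def momentGenDomain (X : BranchingDiffusion n D lam p P) (k : ℕ)
    (G : Set (EuclideanSpace ℝ (Fin n))) (y : EuclideanSpace ℝ (Fin n)) (t : ℝ) : Set ℝ :=
  {s | Summable fun i : ℕ => X.countProb k i G y t * Real.exp (s * i)}

/-- The moment generating function `M_k(G, y, t; s)`. -/
def momentGen (X : BranchingDiffusion n D lam p P) (k : ℕ)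
    (G : Set (EuclideanSpace ℝ (Fin n))) (y : EuclideanSpace ℝ (Fin n)) (t s : ℝ) : ℝ :=
  ∑' i : ℕ, X.countProb k i G y t * Real.exp (s * i)

/-- The expected number of generation-`k` particles in `G` at time `t`. -/
def expectedNumber (X : BranchingDiffusion n D lam p P) (k : ℕ)
    (G : Set (EuclideanSpace ℝ (Fin n))) (y : EuclideanSpace ℝ (Fin n)) (t : ℝ) : ℝ≥0∞ :=
  ∫⁻ ω, (X.count k G y t ω : ℝ≥0∞) ∂P

/-- `A k x y t` are first moment densities: for all `k`, `y`, `t ≥ 0`, except for `k = 0` and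
`t = 0` together (where the expected number is a Dirac mass), the function `A k · y t` is a density
with respect to Lebesgue measure of the expected number of generation-`k` particles. -/
def IsFirstMomentDensity (X : BranchingDiffusion n D lam p P)
    (A : ℕ → EuclideanSpace ℝ (Fin n) → EuclideanSpace ℝ (Fin n) → ℝ → ℝ) : Prop :=
  ∀ (k : ℕ) (y : EuclideanSpace ℝ (Fin n)) (t : ℝ), 0 ≤ t → (0 < t ∨ 1 ≤ k) →
    (Measurable fun x => A k x y t) ∧ (∀ x, 0 ≤ A k x y t) ∧
    ∀ G : Set (EuclideanSpace ℝ (Fin n)), MeasurableSet G →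
      X.expectedNumber k G y t = ∫⁻ x in G, ENNReal.ofReal (A k x y t)

end BranchingDiffusion

/-- The functions `a k x t` (`k ≥ 0`, `x ∈ ℝⁿ`, `t`) solve the recursive system
`∂ₜ aₖ = D Δ aₖ - lam aₖ + lam B aₖ₋₁` (`k ≥ 1`, `t > 0`) with `a₀ = exp (-lam t) p(x, y, t)` for
`t > 0` and initial conditions `a₀ = δ_y`, `aₖ = 0` (`k ≥ 1`) at `t = 0`. The solutions are
classical ones for `t > 0`, bounded in `L¹(ℝⁿ)` on bounded time intervals, and the initial
conditions hold at `t = 0` and as weak limits of measures when `t ↓ 0`. -/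
structure SolvesMomentSystem {n : ℕ} (D lam B : ℝ) (y : EuclideanSpace ℝ (Fin n))
    (a : ℕ → EuclideanSpace ℝ (Fin n) → ℝ → ℝ) : Prop where
  zeroth : ∀ x t, 0 < t → a 0 x t = Real.exp (-lam * t) * diffusionDensity D x y t
  zeroth_initial : ∀ f : EuclideanSpace ℝ (Fin n) →ᵇ ℝ,
    Tendsto (fun t => ∫ x, f x * a 0 x t) (𝓝[>] 0) (𝓝 (f y))
  smooth : ∀ k, 1 ≤ k →
    ContDiffOn ℝ 2 (fun q : EuclideanSpace ℝ (Fin n) × ℝ => a k q.1 q.2)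
      (Set.univ ×ˢ Set.Ioi 0)
  pde : ∀ k, 1 ≤ k → ∀ x t, 0 < t →
    HasDerivAt (fun s => a k x s)
      (D * Laplacian.laplacian (fun x' => a k x' t) x - lam * a k x t + lam * B * a (k - 1) x t) t
  integrable : ∀ k, 1 ≤ k → ∀ t, 0 < t → Integrable fun x => a k x t
  bounded : ∀ k, 1 ≤ k → ∀ T : ℝ, 0 < T → ∃ C : ℝ, ∀ t, 0 < t → t ≤ T → ∫ x, |a k x t| ≤ C
  initial : ∀ k, 1 ≤ k → ∀ x, a k x 0 = 0
  initial_limit : ∀ k, 1 ≤ k → ∀ f : EuclideanSpace ℝ (Fin n) →ᵇ ℝ,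
    Tendsto (fun t => ∫ x, f x * a k x t) (𝓝[>] 0) (𝓝 0)

end

/-! The heart is a many-to-one formula, `tsum_lintegral_producedInd`: summed over all words of
length `k`, the joint law of birth instant and birthplace on the event of being produced is `B ^ k`
times the law of a single Brownian path started at `y` and observed at an independent sum of `k`
exponential times. It goes by induction on `k`. The inputs of a parent are independent of everything
that decides its own birth (`indep_past_inputs`); its `i`-th child exists with conditional
probability `P(N > i)`, and these tails sum to `B`; the lifetime adds one exponential variable, and
the displacements compose by the semigroup property `heat_heat`. The offspring law enters only
through its mean.

A particle born at `b` is alive in `G` at `t` with probability `exp (-lam (t - b))` times a Brownian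
hitting probability for duration `t - b`. By the semigroup property the durations `b` and `t - b`
merge into `t`, so location and birth instant decouple, and the integral over `b` is the Poisson
weight `(lam t) ^ k / k! * exp (-lam t)`. This is `expectedNumber_eq`, from which the finiteness and
the densities follow. The derivative of the moment generating function is dominated convergence for
difference quotients, with care about the possible shapes of the domain.

That the explicit densities solve the system is the product rule together with the heat equation for
the Gaussian. For uniqueness, the difference of two solutions at level `k` solves, by induction, the
homogeneous killed heat equation with zero initial limit. Testing against `cos (⟨ξ, x⟩ + θ)` gives a
function of time that, multiplied by `exp ((lam + D |ξ|²) t)`, is constant; it tends to `0` at time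
`0`, so it vanishes, and Fourier inversion shows that the difference is zero. The plane wave is not
compactly supported, so it is cut off at scale `1 / c`; the `L¹` bound makes the error `O(c)`
uniformly in time. -/

noncomputable section

/-! ### Independence and processes at random times -/

/-- Freezing lemma: independent randomness may be integrated out separately. -/
theorem lintegral_eq_lintegral_lintegral_of_indep {Ω α : Type*} [mα : MeasurableSpace α]
    {m₀ : MeasurableSpace Ω} {P : Measure Ω} [IsProbabilityMeasure P]
    {m₁ m₂ : MeasurableSpace Ω} (h₁ : m₁ ≤ m₀) (h₂ : m₂ ≤ m₀) (hind : Indep m₁ m₂ P)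
    {Z : Ω → α} (hZ : Measurable[m₁] Z) {F : α → Ω → ℝ≥0∞}
    (hF : Measurable[mα.prod m₂] (Function.uncurry F)) :
    ∫⁻ ω, F (Z ω) ω ∂P = ∫⁻ ω, ∫⁻ ω', F (Z ω) ω' ∂P ∂P := by
  -- The identity into `(Ω, m₂)` plays the second random variable: the pair `(Z, id)` then has a
  -- product law, and Tonelli applies.
  have hid : Measurable[m₀, m₂] (id : Ω → Ω) := fun s hs => h₂ s hs
  have hZ0 : Measurable[m₀] Z := hZ.mono h₁ le_rfl
  have hI : @IndepFun Ω α Ω m₀ mα m₂ Z id P := by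
    rw [@IndepFun_iff_Indep]
    refine indep_of_indep_of_le_left ?_ hZ.comap_le
    simpa [MeasurableSpace.comap_id] using hind
  have hmap := (@indepFun_iff_map_prod_eq_prod_map_map Ω α Ω m₀ P Z id mα m₂ _
    hZ0.aemeasurable (@Measurable.aemeasurable Ω Ω m₀ m₂ _ _ hid)).1 hI
  have hprob : @IsProbabilityMeasure Ω m₂ (@Measure.map Ω Ω m₀ m₂ id P) :=
    @Measure.isProbabilityMeasure_map Ω Ω m₀ m₂ P _ _
      (@Measurable.aemeasurable Ω Ω m₀ m₂ _ _ hid)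
  have hpair : @Measurable Ω (α × Ω) m₀ (mα.prod m₂) fun ω => (Z ω, id ω) :=
    Measurable.prodMk hZ0 hid
  have e1 : ∫⁻ ω, F (Z ω) ω ∂P
      = @lintegral (α × Ω) (mα.prod m₂)
        (@Measure.map _ _ m₀ (mα.prod m₂) (fun ω => (Z ω, id ω)) P) (Function.uncurry F) := by
    rw [@lintegral_map _ _ m₀ (mα.prod m₂) _ _ _ hF hpair]
    rfl
  rw [e1, hmap, @lintegral_prod α Ω mα m₂ _ _ _ _ (@Measurable.aemeasurable _ _ (mα.prod m₂) _ _ _ hF),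
    @lintegral_map _ _ m₀ mα _ _ _ (@Measurable.lintegral_prod_right' _ _ mα m₂ _ _ _ hF) hZ0]
  refine lintegral_congr fun ω => ?_
  exact @lintegral_map _ _ m₀ m₂ _ _ _ (@Measurable.of_uncurry_left _ _ _ mα m₂ _ _ hF (Z ω)) hid

/-- A continuous process is measurable when evaluated at a random time. -/
theorem measurable_eval_random_time {Ω E : Type*} [TopologicalSpace E]
    [TopologicalSpace.PseudoMetrizableSpace E] [MeasurableSpace E] [BorelSpace E]
    {m : MeasurableSpace Ω} {W : ℝ≥0 → Ω → E} (hc : ∀ ω, Continuous fun t => W t ω)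
    (hm : ∀ t, Measurable (W t)) {τ : Ω → ℝ≥0} (hτ : Measurable τ) :
    Measurable fun ω => W (τ ω) ω :=
  (measurable_uncurry_of_continuous_of_measurable hc hm).comp (hτ.prodMk measurable_id)

/-- The parameter is absorbed into the sample space, where the time becomes a random time. The
sigma-algebra on `Ω` is left free because the result is applied to those generated by one particle.
-/
theorem measurable_eval_time_uncurry {Ω α E : Type*} [TopologicalSpace E]
    [TopologicalSpace.PseudoMetrizableSpace E] [MeasurableSpace E] [BorelSpace E]
    [MeasurableSpace α] {m : MeasurableSpace Ω} {W : ℝ≥0 → Ω → E}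
    (hc : ∀ ω, Continuous fun t => W t ω) (hm : ∀ t, Measurable (W t)) {τ : α → ℝ≥0}
    (hτ : Measurable τ) : Measurable fun q : α × Ω => W (τ q.1) q.2 :=
  measurable_eval_random_time (W := fun s (q : α × Ω) => W s q.2) (fun q => hc q.2)
    (fun s => (hm s).comp measurable_snd) (hτ.comp measurable_fst)

/-! ### Information carried by particles and generations -/

namespace BranchingDiffusion

variable {n : ℕ} {D lam : ℝ} {p : PMF ℕ} {Ω : Type*} [mΩ : MeasurableSpace Ω] {P : Measure Ω}

/-- The information carried by the inputs of particle `u`. -/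
@[reducible] def inputs (X : BranchingDiffusion n D lam p P) (u : List ℕ) : MeasurableSpace Ω :=
  MeasurableSpace.comap
    (fun ω => (X.life u ω, X.offspring u ω, fun t : ℝ≥0 => X.motion u t ω)) inferInstance

/-- The information carried by the number of children and the motion of particle `u`. -/
@[reducible] def offspringMotion (X : BranchingDiffusion n D lam p P) (u : List ℕ) :
    MeasurableSpace Ω :=
  MeasurableSpace.comap
    (fun ω => (X.offspring u ω, fun t : ℝ≥0 => X.motion u t ω)) inferInstance

/-- The information carried by the inputs of the particles of the generations before `k`. -/
@[reducible] def past (X : BranchingDiffusion n D lam p P) (k : ℕ) : MeasurableSpace Ω :=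
  ⨆ v ∈ {v : List ℕ | v.length < k}, X.inputs v

variable (X : BranchingDiffusion n D lam p P)

theorem measurable_motion (u : List ℕ) (t : ℝ≥0) : Measurable (X.motion u t) :=
  (X.isDiffusion_motion u).measurable t

theorem offspringMotion_le (u : List ℕ) : X.offspringMotion u ≤ mΩ :=
  Measurable.comap_le <| (X.measurable_offspring u).prodMk <|
    measurable_pi_lambda _ fun t => X.measurable_motion u t

theorem inputs_le (u : List ℕ) : X.inputs u ≤ mΩ :=
  Measurable.comap_le <| (X.measurable_life u).prodMk <| (X.measurable_offspring u).prodMk <|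
    measurable_pi_lambda _ fun t => X.measurable_motion u t

theorem past_le (k : ℕ) : X.past k ≤ mΩ := iSup₂_le fun v _ => X.inputs_le v

theorem inputs_le_past {v : List ℕ} {k : ℕ} (h : v.length < k) : X.inputs v ≤ X.past k :=
  le_iSup₂ (f := fun v (_ : v ∈ {v : List ℕ | v.length < k}) => X.inputs v) v h

theorem past_mono {j k : ℕ} (h : j ≤ k) : X.past j ≤ X.past k :=
  iSup₂_le fun _ hv => X.inputs_le_past (lt_of_lt_of_le hv h)

theorem inputs_le_past_cons (i : ℕ) (u : List ℕ) : X.inputs u ≤ X.past (i :: u).length :=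
  X.inputs_le_past (Nat.lt_succ_self _)

theorem past_le_past_cons (i : ℕ) (u : List ℕ) : X.past u.length ≤ X.past (i :: u).length :=
  X.past_mono (Nat.le_succ _)

/-- The labels shorter than `u` and the label `u` itself form disjoint families of independent
inputs. Production, birth and birthplace of `u` depend on the first family only. -/
theorem indep_past_inputs (u : List ℕ) : Indep (X.past u.length) (X.inputs u) P := by
  have h := indep_iSup_of_disjoint (m := X.inputs) X.inputs_le X.indep_particles.iIndep
    (S := {v : List ℕ | v.length < u.length}) (T := {u})
    (Set.disjoint_left.2 fun v hv hu => by
      rw [Set.mem_singleton_iff] at hu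
      rw [hu] at hv
      exact lt_irrefl u.length hv)
  simpa [past] using h

theorem measurable_life_inputs (u : List ℕ) : Measurable[X.inputs u] (X.life u) :=
  measurable_fst.comp (comap_measurable _)

theorem measurable_offspring_inputs (u : List ℕ) : Measurable[X.inputs u] (X.offspring u) :=
  measurable_fst.comp (measurable_snd.comp (comap_measurable _))

theorem measurable_motion_inputs (u : List ℕ) (t : ℝ≥0) :
    Measurable[X.inputs u] (X.motion u t) :=
  (measurable_pi_apply (X := fun _ : ℝ≥0 => EuclideanSpace ℝ (Fin n)) t).comp
    (measurable_snd.comp (measurable_snd.comp (comap_measurable _)))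

theorem measurable_motion_life_inputs (u : List ℕ) :
    Measurable[X.inputs u] fun ω => X.motion u (X.life u ω).toNNReal ω :=
  @measurable_eval_random_time _ _ _ _ _ _ (X.inputs u) _ (X.isDiffusion_motion u).continuous
    (X.measurable_motion_inputs u) _ (measurable_real_toNNReal.comp (X.measurable_life_inputs u))

theorem measurable_birth_past (u : List ℕ) :
    Measurable[X.past u.length] fun ω => X.birth ω u := by
  induction u with
  | nil => exact @measurable_const _ _ _ (X.past _) _
  | cons i u ih =>
    exact (ih.mono (X.past_le_past_cons i u) le_rfl).add
      ((X.measurable_life_inputs u).mono (X.inputs_le_past_cons i u) le_rfl)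

theorem measurable_birthplace_past (y : EuclideanSpace ℝ (Fin n)) (u : List ℕ) :
    Measurable[X.past u.length] fun ω => X.birthplace y ω u := by
  induction u with
  | nil => exact @measurable_const _ _ _ (X.past _) _
  | cons i u ih =>
    exact (ih.mono (X.past_le_past_cons i u) le_rfl).add
      ((X.measurable_motion_life_inputs u).mono (X.inputs_le_past_cons i u) le_rfl)

theorem measurableSet_produced_past (u : List ℕ) :
    MeasurableSet[X.past u.length] {ω | X.Produced ω u} := by
  induction u with
  | nil =>
    simp only [Produced, Set.ofPred_true]
    exact @MeasurableSet.univ _ (X.past _)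
  | cons i u ih =>
    refine @MeasurableSet.inter _ (X.past _) _ _ (X.past_le_past_cons i u _ ih) ?_
    exact X.inputs_le_past_cons i u _
      ((X.measurable_offspring_inputs u) (measurableSet_Ioi (a := i)))

/-- The indicator of the event that `u` is produced. -/
def producedInd (u : List ℕ) : Ω → ℝ≥0∞ := Set.indicator {ω | X.Produced ω u} 1

theorem measurable_producedInd_past (u : List ℕ) :
    Measurable[X.past u.length] (X.producedInd u) :=
  (@measurable_const _ _ _ (X.past _) (1 : ℝ≥0∞)).indicator (X.measurableSet_produced_past u)

theorem producedInd_cons (i : ℕ) (u : List ℕ) (ω : Ω) :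
    X.producedInd (i :: u) ω
      = X.producedInd u ω * Set.indicator {ω | i < X.offspring u ω} 1 ω := by
  classical
  simp only [producedInd, Set.indicator_apply, Set.mem_ofPred_eq, Produced, Pi.one_apply]
  split_ifs <;> simp_all

end BranchingDiffusion

/-! ### Brownian semigroup, and averaging over the inputs of one particle -/

namespace BranchingDiffusion

variable {n : ℕ} {D lam : ℝ} {p : PMF ℕ} {Ω : Type*} [mΩ : MeasurableSpace Ω] {P : Measure Ω}
  (X : BranchingDiffusion n D lam p P)

/-- The mean of `g` at the displacement of a particle of age `s`. -/
def heat (s : ℝ≥0) (g : EuclideanSpace ℝ (Fin n) → ℝ≥0∞) : ℝ≥0∞ :=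
  ∫⁻ ω, g (X.motion [] s ω) ∂P

/-- This lets the motion of the immigrant stand for that of every particle. The case `s = 0` is
separate because the law is prescribed only for positive durations. -/
theorem map_motion (u : List ℕ) (s : ℝ≥0) : P.map (X.motion u s) = P.map (X.motion [] s) := by
  rcases eq_or_ne s 0 with rfl | hs
  · congr 1
    ext1 ω
    rw [(X.isDiffusion_motion u).zero, (X.isDiffusion_motion []).zero]
  · have h : ∀ v, P.map (X.motion v s)
        = volume.withDensity fun x => ENNReal.ofReal (diffusionDensity D x 0 s) := fun v => by
      have := (X.isDiffusion_motion v).law 0 s (pos_iff_ne_zero.2 hs)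
      simpa [(X.isDiffusion_motion v).zero] using this
    rw [h, h]

theorem lintegral_motion (u : List ℕ) (s : ℝ≥0) {g : EuclideanSpace ℝ (Fin n) → ℝ≥0∞}
    (hg : Measurable g) : ∫⁻ ω, g (X.motion u s ω) ∂P = X.heat s g := by
  rw [heat, ← lintegral_map hg (X.measurable_motion u s),
    ← lintegral_map hg (X.measurable_motion [] s), X.map_motion]

theorem measurable_heat [SFinite P] {α : Type*} [MeasurableSpace α]
    {g : α → EuclideanSpace ℝ (Fin n) → ℝ≥0∞}
    (hg : Measurable (Function.uncurry g)) {τ : α → ℝ≥0} (hτ : Measurable τ) :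
    Measurable fun a => X.heat (τ a) (g a) := by
  have h : Measurable fun q : α × Ω => X.motion [] (τ q.1) q.2 :=
    measurable_eval_time_uncurry (X.isDiffusion_motion []).continuous (X.measurable_motion []) hτ
  exact Measurable.lintegral_prod_right' (f := fun q : α × Ω => g q.1 (X.motion [] (τ q.1) q.2))
    (hg.comp (measurable_fst.prodMk h))

theorem map_motion_increment (s t : ℝ≥0) :
    P.map (X.motion [] (s + t) - X.motion [] s) = P.map (X.motion [] t) := by
  rcases eq_or_ne t 0 with rfl | ht
  · congr 1
    ext1 ω
    simp [(X.isDiffusion_motion []).zero]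
  · have h1 := (X.isDiffusion_motion []).law s (s + t) (lt_add_of_pos_right _ (pos_iff_ne_zero.2 ht))
    have h2 := (X.isDiffusion_motion []).law 0 t (pos_iff_ne_zero.2 ht)
    simp only [(X.isDiffusion_motion []).zero, sub_zero, NNReal.coe_zero, NNReal.coe_add,
      add_sub_cancel_left] at h1 h2
    exact h1.trans h2.symm

/-- The increment over `[s, s + t]` is independent of the position at `s` and distributed as the
position at `t`: the semigroup property of Brownian motion. -/
theorem heat_heat [IsProbabilityMeasure P] (s t : ℝ≥0) {g : EuclideanSpace ℝ (Fin n) → ℝ≥0∞}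
    (hg : Measurable g) :
    X.heat s (fun w => X.heat t fun w' => g (w + w')) = X.heat (s + t) g := by
  have hs := X.measurable_motion [] s
  have hd : Measurable (X.motion [] (s + t) - X.motion [] s) :=
    (X.measurable_motion [] (s + t)).sub hs
  have hi : IndepFun (X.motion [] s) (X.motion [] (s + t) - X.motion [] s) P := by
    have := (X.isDiffusion_motion []).indep.indepFun_sub_sub (zero_le (a := s))
      (le_add_of_nonneg_right (zero_le (a := t)))
    have h0 : X.motion [] s - X.motion [] 0 = X.motion [] s := by
      ext1 ω
      simp [(X.isDiffusion_motion []).zero]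
    rwa [h0] at this
  have hg2 : Measurable fun q : EuclideanSpace ℝ (Fin n) × EuclideanSpace ℝ (Fin n) =>
    g (q.1 + q.2) := hg.comp measurable_add
  have e1 : X.heat (s + t) g = ∫⁻ q, g (q.1 + q.2)
      ∂(P.map fun ω => (X.motion [] s ω, (X.motion [] (s + t) - X.motion [] s) ω)) := by
    rw [lintegral_map hg2 (hs.prodMk hd)]
    simp [heat]
  rw [e1, (indepFun_iff_map_prod_eq_prod_map_map hs.aemeasurable hd.aemeasurable).1 hi,
    X.map_motion_increment, lintegral_prod _ hg2.aemeasurable,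
    lintegral_map hg2.lintegral_prod_right' hs]
  refine lintegral_congr fun ω => ?_
  exact (lintegral_map (hg.comp (measurable_const_add (X.motion [] s ω)))
    (X.measurable_motion [] t)).symm

/-- The motion is evaluated at the random lifetime, so the lifetime is frozen first, being
independent of the pair (offspring, motion); at a fixed age the offspring number and the
displacement are independent and the integral factors. -/
theorem lintegral_offspring_mul_life_motion [IsProbabilityMeasure P] (u : List ℕ) (i : ℕ)
    {f : ℝ → EuclideanSpace ℝ (Fin n) → ℝ≥0∞} (hf : Measurable (Function.uncurry f)) :
    ∫⁻ ω, Set.indicator {ω | i < X.offspring u ω} 1 ω *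
        f (X.life u ω) (X.motion u (X.life u ω).toNNReal ω) ∂P
      = P {ω | i < X.offspring u ω} * ∫⁻ l, X.heat l.toNNReal (f l) ∂(expMeasure lam) := by
  have hN : Measurable[(X.offspringMotion u)] (X.offspring u) := measurable_fst.comp (comap_measurable _)
  have hW : ∀ t, Measurable[(X.offspringMotion u)] (X.motion u t) := fun t =>
    (measurable_pi_apply (X := fun _ : ℝ≥0 => EuclideanSpace ℝ (Fin n)) t).comp
      (measurable_snd.comp (comap_measurable _))
  have hset : MeasurableSet[(X.offspringMotion u)] {ω | i < X.offspring u ω} := hN measurableSet_Ioi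
  have hind : Indep (MeasurableSpace.comap (X.life u) inferInstance) (X.offspringMotion u) P := by
    have := X.indep_life u
    rwa [IndepFun_iff_Indep] at this
  have hX : @Measurable (ℝ × Ω) _ (@Prod.instMeasurableSpace _ _ _ (X.offspringMotion u)) _
      fun q : ℝ × Ω => X.motion u q.1.toNNReal q.2 :=
    @measurable_eval_time_uncurry _ _ _ _ _ _ _ _ (X.offspringMotion u) _
      (X.isDiffusion_motion u).continuous hW _ measurable_real_toNNReal
  have hF : @Measurable (ℝ × Ω) _ (@Prod.instMeasurableSpace _ _ _ (X.offspringMotion u)) _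
      (Function.uncurry fun l ω => Set.indicator {ω | i < X.offspring u ω} 1 ω *
        f l (X.motion u l.toNNReal ω)) := by
    refine Measurable.mul ?_ ?_
    · exact ((@measurable_const _ _ _ (X.offspringMotion u) (1 : ℝ≥0∞)).indicator hset).comp
        (@measurable_snd _ _ _ (X.offspringMotion u))
    · exact hf.comp ((@measurable_fst _ _ _ (X.offspringMotion u)).prodMk hX)
  rw [lintegral_eq_lintegral_lintegral_of_indep (X.measurable_life u).comap_le (X.offspringMotion_le u) hind
    (comap_measurable _) hF]
  have e : ∀ l, ∫⁻ ω', Set.indicator {ω | i < X.offspring u ω} 1 ω' *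
        f l (X.motion u l.toNNReal ω') ∂P
      = P {ω | i < X.offspring u ω} * X.heat l.toNNReal (f l) := fun l => by
    have hfl : Measurable (f l) := hf.of_uncurry_left
    have h1 : Measurable fun k : ℕ => Set.indicator (Set.Ioi i) (1 : ℕ → ℝ≥0∞) k :=
      measurable_from_top
    have h2 : Measurable fun w : ℝ≥0 → EuclideanSpace ℝ (Fin n) => f l (w l.toNNReal) :=
      hfl.comp (measurable_pi_apply (X := fun _ : ℝ≥0 => EuclideanSpace ℝ (Fin n)) _)
    have := lintegral_mul_eq_lintegral_mul_lintegral_of_indepFun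
      (h1.comp (X.measurable_offspring u))
      (hfl.comp (X.measurable_motion u l.toNNReal)) ((X.indep_offspring u).comp h1 h2)
    simp only [Pi.mul_apply, Function.comp_apply] at this
    rw [← X.lintegral_motion u _ hfl,
      ← lintegral_indicator_one (X.offspringMotion_le u _ hset)]
    exact this
  have hl : Measurable fun l : ℝ => X.heat l.toNNReal (f l) :=
    X.measurable_heat hf measurable_real_toNNReal
  simp_rw [e]
  rw [lintegral_const_mul' _ _ (measure_ne_top _ _), ← X.law_life u,
    lintegral_map hl (X.measurable_life u)]

theorem measurable_motion_uncurry (u : List ℕ) {α : Type*} [MeasurableSpace α] {τ : α → ℝ≥0}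
    (hτ : Measurable τ) : @Measurable (α × Ω) _ (@Prod.instMeasurableSpace _ _ _ (X.inputs u)) _
      fun q : α × Ω => X.motion u (τ q.1) q.2 :=
  @measurable_eval_time_uncurry _ _ _ _ _ _ _ _ (X.inputs u) _
    (X.isDiffusion_motion u).continuous (X.measurable_motion_inputs u) _ hτ

/-- The inputs of a particle may be integrated out, given its birth. -/
theorem lintegral_producedInd_mul [IsProbabilityMeasure P] (y : EuclideanSpace ℝ (Fin n))
    (u : List ℕ) {F : ℝ × EuclideanSpace ℝ (Fin n) → Ω → ℝ≥0∞}
    (hF : @Measurable _ _ (@Prod.instMeasurableSpace _ _ _ (X.inputs u)) _ (Function.uncurry F)) :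
    ∫⁻ ω, X.producedInd u ω * F (X.birth ω u, X.birthplace y ω u) ω ∂P
      = ∫⁻ ω, X.producedInd u ω * ∫⁻ ω', F (X.birth ω u, X.birthplace y ω u) ω' ∂P ∂P := by
  -- Production, birth instant and birthplace are all decided by earlier generations, so they can be
  -- frozen together.
  have hZ : Measurable[X.past u.length]
      fun ω => (X.producedInd u ω, (X.birth ω u, X.birthplace y ω u)) :=
    (X.measurable_producedInd_past u).prodMk
      ((X.measurable_birth_past u).prodMk (X.measurable_birthplace_past y u))
  have hF0 : Measurable (Function.uncurry F) :=
    hF.mono (sup_le_sup le_rfl (MeasurableSpace.comap_mono (X.inputs_le u))) le_rfl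
  have := lintegral_eq_lintegral_lintegral_of_indep (X.past_le _) (X.inputs_le u)
    (X.indep_past_inputs u) hZ (F := fun z ω => z.1 * F z.2 ω) ?_
  · refine this.trans (lintegral_congr fun ω => ?_)
    exact lintegral_const_mul _ hF0.of_uncurry_left
  · refine Measurable.mul ?_ ?_
    · exact measurable_fst.comp (@measurable_fst _ _ _ (X.inputs u))
    · exact hF.comp ((measurable_snd.comp (@measurable_fst _ _ _ (X.inputs u))).prodMk
        (@measurable_snd _ _ _ (X.inputs u)))

/-- One step of the genealogy: given the birth of the parent, its lifetime and displacement shift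
the birth data, and the existence of child `i` contributes an independent factor. This drives the
induction on generations. -/
theorem lintegral_producedInd_cons [IsProbabilityMeasure P] (y : EuclideanSpace ℝ (Fin n))
    (i : ℕ) (u : List ℕ) {f : ℝ → EuclideanSpace ℝ (Fin n) → ℝ≥0∞}
    (hf : Measurable (Function.uncurry f)) :
    ∫⁻ ω, X.producedInd (i :: u) ω * f (X.birth ω (i :: u)) (X.birthplace y ω (i :: u)) ∂P
      = P {ω | i < X.offspring u ω} * ∫⁻ ω, X.producedInd u ω *
        ∫⁻ l, X.heat l.toNNReal (fun w => f (X.birth ω u + l) (X.birthplace y ω u + w))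
          ∂(expMeasure lam) ∂P := by
  have hset : MeasurableSet[X.inputs u] {ω | i < X.offspring u ω} :=
    X.measurable_offspring_inputs u measurableSet_Ioi
  have hI : @Measurable ((ℝ × EuclideanSpace ℝ (Fin n)) × Ω) _
      (@Prod.instMeasurableSpace _ _ _ (X.inputs u)) _
      fun q => Set.indicator {ω | i < X.offspring u ω} (1 : Ω → ℝ≥0∞) q.2 :=
    ((@measurable_const _ _ _ (X.inputs u) (1 : ℝ≥0∞)).indicator hset).comp
      (@measurable_snd _ _ _ (X.inputs u))
  have h1 : @Measurable ((ℝ × EuclideanSpace ℝ (Fin n)) × Ω) _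
      (@Prod.instMeasurableSpace _ _ _ (X.inputs u)) _ fun q => q.1.1 + X.life u q.2 :=
    (measurable_fst.comp (@measurable_fst _ _ _ (X.inputs u))).add
      ((X.measurable_life_inputs u).comp (@measurable_snd _ _ _ (X.inputs u)))
  have h2 : @Measurable ((ℝ × EuclideanSpace ℝ (Fin n)) × Ω) _
      (@Prod.instMeasurableSpace _ _ _ (X.inputs u)) _
      fun q => q.1.2 + X.motion u (X.life u q.2).toNNReal q.2 :=
    (measurable_snd.comp (@measurable_fst _ _ _ (X.inputs u))).add
      ((X.measurable_motion_life_inputs u).comp (@measurable_snd _ _ _ (X.inputs u)))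
  have h := X.lintegral_producedInd_mul y u (F := fun z ω =>
    Set.indicator {ω | i < X.offspring u ω} 1 ω *
      f (z.1 + X.life u ω) (z.2 + X.motion u (X.life u ω).toNNReal ω))
    (hI.mul (hf.comp (h1.prodMk h2)))
  have e : ∀ (b : ℝ) (x : EuclideanSpace ℝ (Fin n)),
      ∫⁻ ω', Set.indicator {ω | i < X.offspring u ω} 1 ω' *
        f (b + X.life u ω') (x + X.motion u (X.life u ω').toNNReal ω') ∂P
      = P {ω | i < X.offspring u ω} *
        ∫⁻ l, X.heat l.toNNReal (fun w => f (b + l) (x + w)) ∂(expMeasure lam) := fun b x =>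
    X.lintegral_offspring_mul_life_motion u i (f := fun l w => f (b + l) (x + w))
      (hf.comp ((measurable_fst.const_add b).prodMk (measurable_snd.const_add x)))
  simp only [e] at h
  simp only [producedInd_cons, birth, birthplace, mul_assoc]
  rw [h]
  simp only [mul_left_comm _ (P _) _]
  have hfin : P {ω | i < X.offspring u ω} ≠ ∞ := measure_ne_top _ _
  rw [lintegral_const_mul' _ _ hfin]

end BranchingDiffusion

/-! ### Sums of exponential lifetimes -/

/-- In both integrals over a birth instant `b` below, the exponentials multiply to a factor free of
`b`; that factor goes into `K`, and only this power integral remains. -/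
theorem lintegral_Icc_pow (K c : ℝ) (hK : 0 ≤ K) (hc : 0 ≤ c) (k : ℕ) :
    ∫⁻ b in Set.Icc 0 c, ENNReal.ofReal (K * (b ^ k / k.factorial))
      = ENNReal.ofReal (K * (c ^ (k + 1) / (k + 1).factorial)) := by
  rw [← ofReal_integral_eq_lintegral_ofReal]
  · rw [integral_Icc_eq_integral_Ioc, ← intervalIntegral.integral_of_le hc,
      intervalIntegral.integral_const_mul, intervalIntegral.integral_div, integral_pow]
    congr 2
    rw [Nat.factorial_succ]
    push_cast
    field_simp
    simp
  · exact (by fun_prop : Continuous fun b : ℝ => K * (b ^ k / k.factorial)).integrableOn_Icc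
  · filter_upwards [ae_restrict_mem measurableSet_Icc] with b hb
    have := hb.1
    positivity

/-- The density of the sum of `k + 1` independent exponential times with rate `lam`. -/
def erlangDensity (lam : ℝ) (k : ℕ) : ℝ → ℝ≥0∞ :=
  Set.indicator (Set.Ici 0) fun b =>
    ENNReal.ofReal (lam ^ (k + 1) * (b ^ k / k.factorial) * Real.exp (-(lam * b)))

/-- The law of the sum of `k` independent exponential times with rate `lam`. -/
def erlangMeasure (lam : ℝ) : ℕ → Measure ℝ
  | 0 => Measure.dirac 0
  | k + 1 => volume.withDensity (erlangDensity lam k)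

theorem measurable_erlangDensity (lam : ℝ) (k : ℕ) : Measurable (erlangDensity lam k) :=
  Measurable.indicator (by fun_prop) measurableSet_Ici

instance (lam : ℝ) (k : ℕ) : SFinite (erlangMeasure lam k) := by
  cases k <;> (unfold erlangMeasure; infer_instance)

theorem expMeasure_eq_withDensity (lam : ℝ) :
    expMeasure lam = volume.withDensity (erlangDensity lam 0) := by
  rw [expMeasure, gammaMeasure]
  congr 1
  ext b
  rw [gammaPDF, gammaPDFReal, erlangDensity, Set.indicator_apply]
  by_cases hb : 0 ≤ b <;> simp [hb]

/-- `Real.toNNReal` is additive only on nonnegative reals, so durations may be added in the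
semigroup property only where births and lifetimes are nonnegative. -/
theorem ae_nonneg_erlangMeasure (lam : ℝ) (k : ℕ) : ∀ᵐ b ∂erlangMeasure lam k, 0 ≤ b := by
  cases k with
  | zero =>
    rw [erlangMeasure, ae_dirac_iff measurableSet_Ici]
  | succ k =>
    rw [erlangMeasure, ae_withDensity_iff (measurable_erlangDensity lam k)]
    refine Eventually.of_forall fun b hb => ?_
    by_contra h
    exact hb (Set.indicator_of_notMem h _)

/-- The product is supported on `[0, c]`, where `exp (-lam b) * exp (-lam (c - b))` no longer
depends on `b`. For `c < 0` the supports do not meet. -/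
theorem lintegral_erlangDensity_mul (lam : ℝ) (hlam : 0 < lam) (k : ℕ) (c : ℝ) :
    ∫⁻ b, erlangDensity lam k b * erlangDensity lam 0 (c - b) = erlangDensity lam (k + 1) c := by
  rcases lt_or_ge c 0 with hc | hc
  · rw [erlangDensity.eq_def lam (k + 1), Set.indicator_of_notMem (by simpa using hc)]
    refine (lintegral_congr fun b => ?_).trans lintegral_zero
    simp only [erlangDensity, Set.indicator_apply, Set.mem_Ici]
    by_cases hb : 0 ≤ b
    · rw [if_neg (by linarith : ¬ 0 ≤ c - b)]
      simp
    · rw [if_neg hb]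
      simp
  · have e : ∀ b, erlangDensity lam k b * erlangDensity lam 0 (c - b)
        = (Set.Icc 0 c).indicator (fun b => ENNReal.ofReal
          (lam ^ (k + 2) * Real.exp (-(lam * c)) * (b ^ k / k.factorial))) b := fun b => by
      simp only [erlangDensity, Set.indicator_apply, Set.mem_Ici, Set.mem_Icc, sub_nonneg]
      by_cases hb : 0 ≤ b
      · by_cases hb' : b ≤ c
        · simp only [hb, hb', if_true, and_self]
          rw [← ENNReal.ofReal_mul (by positivity)]
          congr 1
          have : Real.exp (-(lam * c)) = Real.exp (-(lam * b)) * Real.exp (-(lam * (c - b))) := by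
            rw [← Real.exp_add]
            ring_nf
          rw [this]
          simp
          ring
        · simp [hb']
      · simp [hb]
    simp_rw [e]
    rw [lintegral_indicator measurableSet_Icc, lintegral_Icc_pow _ _ (by positivity) hc,
      erlangDensity, Set.indicator_of_mem (by simpa using hc)]
    congr 1
    ring

/-- For positive `k` this is the substitution `c = b + l`, Tonelli and the convolution of densities.
The case `k = 0` is separate since the Dirac law has no density. -/
theorem lintegral_erlangMeasure_succ (lam : ℝ) (hlam : 0 < lam) (k : ℕ) {φ : ℝ → ℝ≥0∞}
    (hφ : Measurable φ) :
    ∫⁻ b, ∫⁻ l, φ (b + l) ∂expMeasure lam ∂erlangMeasure lam k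
      = ∫⁻ b, φ b ∂erlangMeasure lam (k + 1) := by
  have hm := measurable_erlangDensity lam
  rw [expMeasure_eq_withDensity]
  cases k with
  | zero =>
    rw [erlangMeasure, lintegral_dirac]
    simp [erlangMeasure]
  | succ k =>
    have e : ∀ b, ∫⁻ l, φ (b + l) ∂(volume.withDensity (erlangDensity lam 0))
        = ∫⁻ c, erlangDensity lam 0 (c - b) * φ c := fun b => by
      have hb : Measurable fun l => φ (b + l) := hφ.comp (measurable_const_add b)
      rw [lintegral_withDensity_eq_lintegral_mul _ (hm 0) hb,
        ← lintegral_add_left_eq_self (fun c => erlangDensity lam 0 (c - b) * φ c) b]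
      simp
    have hm2 : Measurable (Function.uncurry fun b c : ℝ => erlangDensity lam 0 (c - b) * φ c) :=
      ((hm 0).comp (measurable_snd.sub measurable_fst)).mul (hφ.comp measurable_snd)
    have hm3 : Measurable fun b => ∫⁻ c, erlangDensity lam 0 (c - b) * φ c :=
      hm2.lintegral_prod_right'
    simp_rw [e]
    rw [erlangMeasure, erlangMeasure,
      lintegral_withDensity_eq_lintegral_mul _ (hm k) hm3,
      lintegral_withDensity_eq_lintegral_mul _ (hm (k + 1)) hφ]
    simp only [Pi.mul_apply]
    calc ∫⁻ b, erlangDensity lam k b * ∫⁻ c, erlangDensity lam 0 (c - b) * φ c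
        = ∫⁻ b, ∫⁻ c, erlangDensity lam k b * (erlangDensity lam 0 (c - b) * φ c) :=
          lintegral_congr fun b => (lintegral_const_mul _ hm2.of_uncurry_left).symm
      _ = ∫⁻ c, ∫⁻ b, erlangDensity lam k b * (erlangDensity lam 0 (c - b) * φ c) :=
          lintegral_lintegral_swap (((hm k).comp measurable_fst).mul hm2).aemeasurable
      _ = ∫⁻ c, erlangDensity lam (k + 1) c * φ c := lintegral_congr fun c => by
          rw [← lintegral_erlangDensity_mul lam hlam, ← lintegral_mul_const]
          · simp only [mul_assoc]
          · exact (hm k).mul ((hm 0).comp (measurable_const.sub measurable_id))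

/-- Exactly `k` splittings along a line of descent occur by time `t` when the `k`-th one happens at
some `b ≤ t` and the next lifetime exceeds `t - b`; hence the Poisson weight. -/
theorem lintegral_erlangMeasure_survival (lam : ℝ) (hlam : 0 < lam) (k : ℕ) (t : ℝ)
    (ht : 0 ≤ t) :
    ∫⁻ b, (Set.Iic t).indicator (fun b => ENNReal.ofReal (Real.exp (-(lam * (t - b))))) b
        ∂erlangMeasure lam k
      = ENNReal.ofReal ((lam * t) ^ k / k.factorial * Real.exp (-(lam * t))) := by
  have hmeas : Measurable
      ((Set.Iic t).indicator fun b => ENNReal.ofReal (Real.exp (-(lam * (t - b))))) :=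
    Measurable.indicator (by fun_prop) measurableSet_Iic
  cases k with
  | zero =>
    rw [erlangMeasure, lintegral_dirac' _ hmeas]
    simp [ht]
  | succ k =>
    rw [erlangMeasure,
      lintegral_withDensity_eq_lintegral_mul _ (measurable_erlangDensity lam k) hmeas]
    have e : ∀ b, (erlangDensity lam k *
        (Set.Iic t).indicator fun b => ENNReal.ofReal (Real.exp (-(lam * (t - b))))) b
        = (Set.Icc 0 t).indicator (fun b => ENNReal.ofReal
          (lam ^ (k + 1) * Real.exp (-(lam * t)) * (b ^ k / k.factorial))) b := fun b => by
      simp only [erlangDensity, Set.indicator_apply, Set.mem_Ici, Set.mem_Icc, Pi.mul_apply,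
        Set.mem_Iic]
      by_cases hb : 0 ≤ b
      · by_cases hb' : b ≤ t
        · simp only [hb, hb', if_true, and_self]
          rw [← ENNReal.ofReal_mul (by positivity)]
          congr 1
          have : Real.exp (-(lam * t)) = Real.exp (-(lam * b)) * Real.exp (-(lam * (t - b))) := by
            rw [← Real.exp_add]
            ring_nf
          rw [this]
          ring
        · simp [hb']
      · simp [hb]
    simp_rw [e]
    rw [lintegral_indicator measurableSet_Icc, lintegral_Icc_pow _ _ (by positivity) ht]
    congr 1
    ring

theorem expMeasure_Ioi (lam : ℝ) (hlam : 0 < lam) {s : ℝ} (hs : 0 ≤ s) :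
    expMeasure lam (Set.Ioi s) = ENNReal.ofReal (Real.exp (-(lam * s))) := by
  have : IsProbabilityMeasure (expMeasure lam) := isProbabilityMeasure_expMeasure hlam
  have h := cdf_expMeasure_eq hlam s
  rw [if_pos hs, cdf_eq_real] at h
  rw [← Set.compl_Iic, ← ofReal_measureReal, probReal_compl_eq_one_sub measurableSet_Iic, h]
  ring_nf

/-! ### Tails of the offspring law and words of given length -/

/-- The mean of a distribution on the natural numbers is the sum of its tails. -/
theorem tsum_toMeasure_Ioi (p : PMF ℕ) {B : ℝ}
    (hB : HasSum (fun i : ℕ => (i : ℝ) * (p i).toReal) B) :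
    ∑' i, p.toMeasure (Set.Ioi i) = ENNReal.ofReal B := by
  have h0 : ∀ i : ℕ, 0 ≤ (i : ℝ) * (p i).toReal := fun i => by positivity
  rw [← hB.tsum_eq, ENNReal.ofReal_tsum_of_nonneg h0 hB.summable]
  have e : ∀ i, p.toMeasure (Set.Ioi i) = ∑' j, (Set.Iio j).indicator (fun _ => p j) i := fun i => by
    rw [p.toMeasure_apply]
    · refine tsum_congr fun j => ?_
      simp [Set.indicator_apply]
    · exact measurableSet_Ioi
  simp_rw [e]
  rw [ENNReal.tsum_comm]
  refine tsum_congr fun j => ?_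
  rw [ENNReal.ofReal_mul (by positivity), ENNReal.ofReal_toReal (p.apply_ne_top j),
    tsum_eq_sum (s := Finset.range j) (fun i hi => Set.indicator_of_notMem (by simpa using hi) _)]
  rw [Finset.sum_congr rfl (fun i hi => Set.indicator_of_mem (by simpa using hi) _)]
  simp

/-- Lists of length `k + 1` are pairs of a head and a list of length `k`. -/
def listLengthSuccEquiv (α : Type*) (k : ℕ) :
    {u : List α // u.length = k + 1} ≃ {u : List α // u.length = k} × α where
  toFun u := (⟨u.1.tail, by simp [u.2]⟩, u.1.head (by
    intro h
    have := u.2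
    simp [h] at this))
  invFun q := ⟨q.2 :: q.1.1, by simp [q.1.2]⟩
  left_inv u := Subtype.ext (by simp)
  right_inv q := by simp

/-! ### Birth intensity and the first moment formula -/

namespace BranchingDiffusion

variable {n : ℕ} {D lam : ℝ} {p : PMF ℕ} {Ω : Type*} [mΩ : MeasurableSpace Ω] {P : Measure Ω}
  (X : BranchingDiffusion n D lam p P)

theorem measure_lt_offspring (u : List ℕ) (i : ℕ) :
    P {ω | i < X.offspring u ω} = p.toMeasure (Set.Ioi i) := by
  rw [← X.law_offspring u, Measure.map_apply (X.measurable_offspring u) measurableSet_Ioi]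
  rfl

/-- The intensity measure of births of generation `k`. -/
theorem tsum_lintegral_producedInd [IsProbabilityMeasure P] (hlam : 0 < lam) {B : ℝ}
    (hB : HasSum (fun i : ℕ => (i : ℝ) * (p i).toReal) B) (y : EuclideanSpace ℝ (Fin n))
    (k : ℕ) {f : ℝ → EuclideanSpace ℝ (Fin n) → ℝ≥0∞} (hf : Measurable (Function.uncurry f)) :
    ∑' u : {u : List ℕ // u.length = k},
        ∫⁻ ω, X.producedInd u ω * f (X.birth ω u) (X.birthplace y ω u) ∂P
      = ENNReal.ofReal B ^ k *
        ∫⁻ b, X.heat b.toNNReal (fun w => f b (y + w)) ∂erlangMeasure lam k := by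
  -- The test function must vary: the induction hypothesis is applied to `T`, the average of `f`
  -- over one further life.
  induction k generalizing f with
  | zero =>
    rw [tsum_eq_single (⟨[], rfl⟩ : {u : List ℕ // u.length = 0})
      (fun u hu => (hu (Subtype.ext (List.length_eq_zero_iff.1 u.2))).elim)]
    have hm : Measurable fun b : ℝ => X.heat b.toNNReal (fun w => f b (y + w)) :=
      X.measurable_heat (g := fun b w => f b (y + w))
        (hf.comp (measurable_fst.prodMk (measurable_snd.const_add y))) measurable_real_toNNReal
    rw [erlangMeasure, lintegral_dirac' _ hm]
    simp [producedInd, Produced, birth, birthplace, heat, (X.isDiffusion_motion []).zero]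
  | succ k ih =>
    have : SFinite (expMeasure lam) := by
      rw [expMeasure_eq_withDensity]
      infer_instance
    set T : ℝ → EuclideanSpace ℝ (Fin n) → ℝ≥0∞ := fun b x =>
      ∫⁻ l, X.heat l.toNNReal (fun w => f (b + l) (x + w)) ∂expMeasure lam with hT
    have hf2 : Measurable fun r : ((ℝ × EuclideanSpace ℝ (Fin n)) × ℝ) ×
        EuclideanSpace ℝ (Fin n) => (r.1.1.1 + r.1.2, r.1.1.2 + r.2) := by fun_prop
    have hG : Measurable fun q : ((ℝ × EuclideanSpace ℝ (Fin n)) × ℝ) =>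
        X.heat q.2.toNNReal (fun w => f (q.1.1 + q.2) (q.1.2 + w)) :=
      X.measurable_heat (g := fun (q : ((ℝ × EuclideanSpace ℝ (Fin n)) × ℝ)) w =>
          f (q.1.1 + q.2) (q.1.2 + w)) (hf.comp hf2)
        (measurable_real_toNNReal.comp measurable_snd)
    have hTm : Measurable (Function.uncurry T) := hG.lintegral_prod_right'
    have hφ : Measurable fun b : ℝ => X.heat b.toNNReal (fun w => f b (y + w)) :=
      X.measurable_heat (g := fun b w => f b (y + w))
        (hf.comp (measurable_fst.prodMk (measurable_snd.const_add y))) measurable_real_toNNReal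
    have e1 : ∑' u : {u : List ℕ // u.length = k + 1},
        ∫⁻ ω, X.producedInd u ω * f (X.birth ω u) (X.birthplace y ω u) ∂P
        = ENNReal.ofReal B * ∑' u : {u : List ℕ // u.length = k},
          ∫⁻ ω, X.producedInd u ω * T (X.birth ω u) (X.birthplace y ω u) ∂P := by
      rw [← (listLengthSuccEquiv ℕ k).symm.tsum_eq, ENNReal.tsum_prod', ← ENNReal.tsum_mul_left]
      refine tsum_congr fun u => ?_
      rw [← tsum_toMeasure_Ioi p hB, ← ENNReal.tsum_mul_right]
      refine tsum_congr fun i => ?_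
      rw [← X.measure_lt_offspring u.1 i]
      exact X.lintegral_producedInd_cons y i u.1 hf
    rw [e1, ih hTm, pow_succ', mul_assoc]
    congr 2
    rw [← lintegral_erlangMeasure_succ lam hlam k hφ]
    refine lintegral_congr_ae ?_
    filter_upwards [ae_nonneg_erlangMeasure lam k] with b hb
    -- The lifetime integral is moved outside, so that the two displacements, of durations `b` and
    -- `l`, stand next to each other and compose.
    have e2 : X.heat b.toNNReal (fun w => T b (y + w)) = ∫⁻ l, X.heat b.toNNReal
        (fun w => X.heat l.toNNReal (fun w' => f (b + l) (y + w + w'))) ∂expMeasure lam := by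
      simp only [heat, hT]
      refine lintegral_lintegral_swap (Measurable.aemeasurable ?_)
      exact hG.comp ((measurable_const.prodMk
        (((X.measurable_motion [] _).comp measurable_fst).const_add y)).prodMk measurable_snd)
    rw [e2]
    refine lintegral_congr_ae ?_
    have h0 := ae_nonneg_erlangMeasure lam 1
    rw [erlangMeasure, ← expMeasure_eq_withDensity] at h0
    filter_upwards [h0] with l hl
    have hg : Measurable fun w => f (b + l) (y + w) :=
      hf.comp (measurable_const.prodMk (measurable_const_add y))
    have := X.heat_heat b.toNNReal l.toNNReal hg
    simp only [← add_assoc] at this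
    rw [this, Real.toNNReal_add hb hl]

/-- As a countable sum of indicators the count is measurable, and its expectation is a sum of
probabilities over words. -/
theorem count_eq_tsum (k : ℕ) (G : Set (EuclideanSpace ℝ (Fin n)))
    (y : EuclideanSpace ℝ (Fin n)) (t : ℝ) (ω : Ω) :
    (X.count k G y t ω : ℝ≥0∞) = ∑' u : {u : List ℕ // u.length = k},
      Set.indicator {ω | X.Alive ω u t ∧ X.position y ω u t ∈ G} (1 : Ω → ℝ≥0∞) ω := by
  rw [count, ← ENNReal.tsum_set_one, tsum_subtype
    {u : List ℕ | u.length = k ∧ X.Alive ω u t ∧ X.position y ω u t ∈ G} (fun _ => (1 : ℝ≥0∞))]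
  rw [← tsum_subtype_eq_of_support_subset (s := {u : List ℕ | u.length = k})]
  · refine tsum_congr fun u => ?_
    classical
    have hu : (u : List ℕ).length = k := u.2
    simp [Set.indicator_apply, hu]
  · intro u hu
    by_contra h
    exact hu (Set.indicator_of_notMem (fun h' => h h'.1) _)

theorem measurable_position (y : EuclideanSpace ℝ (Fin n)) (u : List ℕ) (t : ℝ) :
    Measurable fun ω => X.position y ω u t :=
  ((X.measurable_birthplace_past y u).mono (X.past_le _) le_rfl).add
    (measurable_eval_random_time (X.isDiffusion_motion u).continuous (X.measurable_motion u)
      (measurable_real_toNNReal.comp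
        (measurable_const.sub ((X.measurable_birth_past u).mono (X.past_le _) le_rfl))))

theorem measurableSet_alive_position {G : Set (EuclideanSpace ℝ (Fin n))} (hG : MeasurableSet G)
    (y : EuclideanSpace ℝ (Fin n)) (u : List ℕ) (t : ℝ) :
    MeasurableSet {ω | X.Alive ω u t ∧ X.position y ω u t ∈ G} := by
  have hb := (X.measurable_birth_past u).mono (X.past_le _) le_rfl
  exact (((X.past_le _ _ (X.measurableSet_produced_past u)).inter
    ((measurableSet_le hb measurable_const).inter
      (measurableSet_lt measurable_const (hb.add (X.measurable_life u))))).inter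
        (X.measurable_position y u t hG))

theorem measurable_count {G : Set (EuclideanSpace ℝ (Fin n))} (hG : MeasurableSet G) (k : ℕ)
    (y : EuclideanSpace ℝ (Fin n)) (t : ℝ) :
    Measurable fun ω => (X.count k G y t ω : ℝ≥0∞) := by
  simp_rw [X.count_eq_tsum]
  exact Measurable.tsum fun u =>
    measurable_one.indicator (X.measurableSet_alive_position hG y u t)

theorem lintegral_life_motion [IsProbabilityMeasure P] (u : List ℕ) (s : ℝ) (r : ℝ≥0)
    {g : EuclideanSpace ℝ (Fin n) → ℝ≥0∞} (hg : Measurable g) :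
    ∫⁻ ω, Set.indicator {ω | s < X.life u ω} 1 ω * g (X.motion u r ω) ∂P
      = expMeasure lam (Set.Ioi s) * X.heat r g := by
  have h1 : Measurable ((Set.Ioi s).indicator (1 : ℝ → ℝ≥0∞)) :=
    measurable_one.indicator measurableSet_Ioi
  have h2 : Measurable fun w : ℕ × (ℝ≥0 → EuclideanSpace ℝ (Fin n)) => g (w.2 r) :=
    hg.comp ((measurable_pi_apply (X := fun _ : ℝ≥0 => EuclideanSpace ℝ (Fin n)) r).comp
      measurable_snd)
  have := lintegral_mul_eq_lintegral_mul_lintegral_of_indepFun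
    (h1.comp (X.measurable_life u)) (hg.comp (X.measurable_motion u r))
    ((X.indep_life u).comp h1 h2)
  rw [← X.lintegral_motion u r hg, ← X.law_life u,
    Measure.map_apply (X.measurable_life u) measurableSet_Ioi,
    ← lintegral_indicator_one (X.measurable_life u measurableSet_Ioi)]
  exact this

/-- The expected numbers: the first moment formula. -/
theorem expectedNumber_eq [IsProbabilityMeasure P] (hlam : 0 < lam) {B : ℝ}
    (hB : HasSum (fun i : ℕ => (i : ℝ) * (p i).toReal) B) (k : ℕ)
    {G : Set (EuclideanSpace ℝ (Fin n))} (hG : MeasurableSet G)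
    (y : EuclideanSpace ℝ (Fin n)) {t : ℝ} (ht : 0 ≤ t) :
    X.expectedNumber k G y t
      = ENNReal.ofReal B ^ k *
        (ENNReal.ofReal ((lam * t) ^ k / k.factorial * Real.exp (-(lam * t))) *
          X.heat t.toNNReal (fun w => G.indicator 1 (y + w))) := by
  -- The conditional probability that a produced particle born at time `b` at the point `x` is alive
  -- and in `G` at time `t`.
  set h : ℝ → EuclideanSpace ℝ (Fin n) → ℝ≥0∞ := fun b x =>
    (Set.Iic t).indicator (fun b => ENNReal.ofReal (Real.exp (-(lam * (t - b))))) b *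
      X.heat (t - b).toNNReal (fun w => G.indicator 1 (x + w)) with hh
  have hGm : Measurable (G.indicator (1 : EuclideanSpace ℝ (Fin n) → ℝ≥0∞)) :=
    measurable_one.indicator hG
  have hsurv : Measurable
      ((Set.Iic t).indicator fun b => ENNReal.ofReal (Real.exp (-(lam * (t - b))))) :=
    Measurable.indicator (by fun_prop) measurableSet_Iic
  have hhm : Measurable (Function.uncurry h) := by
    refine (hsurv.comp measurable_fst).mul ?_
    exact X.measurable_heat
      (g := fun (q : ℝ × EuclideanSpace ℝ (Fin n)) w => G.indicator 1 (q.2 + w))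
      (hGm.comp (by fun_prop)) (by fun_prop)
  have key : ∀ u : List ℕ, P {ω | X.Alive ω u t ∧ X.position y ω u t ∈ G}
      = ∫⁻ ω, X.producedInd u ω * h (X.birth ω u) (X.birthplace y ω u) ∂P := fun u => by
    rw [← lintegral_indicator_one (X.measurableSet_alive_position hG y u t)]
    -- With the birth data `z` as a parameter, the event involves only the inputs of `u`, so these
    -- can be averaged out separately.
    have hF : @Measurable ((ℝ × EuclideanSpace ℝ (Fin n)) × Ω) _
        (@Prod.instMeasurableSpace _ _ _ (X.inputs u)) _
        (Function.uncurry fun (z : ℝ × EuclideanSpace ℝ (Fin n)) ω =>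
          (Set.Iic t).indicator (1 : ℝ → ℝ≥0∞) z.1 *
          (Set.indicator {q : ℝ × ℝ | t - q.1 < q.2} (1 : ℝ × ℝ → ℝ≥0∞) (z.1, X.life u ω) *
          G.indicator (1 : EuclideanSpace ℝ (Fin n) → ℝ≥0∞)
            (z.2 + X.motion u (t - z.1).toNNReal ω))) := by
      have m0 := @measurable_fst (ℝ × EuclideanSpace ℝ (Fin n)) Ω inferInstance (X.inputs u)
      have m1 := Measurable.comp measurable_fst m0
      have m2 := Measurable.comp measurable_snd m0
      have m3 := (X.measurable_life_inputs u).comp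
        (@measurable_snd (ℝ × EuclideanSpace ℝ (Fin n)) Ω inferInstance (X.inputs u))
      have m4 := X.measurable_motion_uncurry u
        (τ := fun z : ℝ × EuclideanSpace ℝ (Fin n) => (t - z.1).toNNReal) (by fun_prop)
      refine ((Measurable.indicator measurable_one measurableSet_Iic).comp m1).mul (Measurable.mul ?_ ?_)
      · exact (measurable_one.indicator
          (measurableSet_lt (measurable_const.sub measurable_fst) measurable_snd)).comp
          (m1.prodMk m3)
      · exact hGm.comp (m2.add m4)
    refine Eq.trans (lintegral_congr fun ω => ?_) ((X.lintegral_producedInd_mul y u hF).trans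
      (lintegral_congr fun ω => ?_))
    · classical
      simp only [producedInd, Set.indicator_apply, Set.mem_ofPred_eq, Set.mem_Iic, Pi.one_apply,
        Alive, position, sub_lt_iff_lt_add']
      split_ifs <;> simp_all
    · congr 1
      rw [lintegral_const_mul']
      · have := X.lintegral_life_motion u (t - X.birth ω u) (t - X.birth ω u).toNNReal
          (g := fun w => G.indicator 1 (X.birthplace y ω u + w))
          (hGm.comp (measurable_const_add _))
        simp only [hh]
        rw [show ∫⁻ ω', Set.indicator {q : ℝ × ℝ | t - q.1 < q.2} (1 : ℝ × ℝ → ℝ≥0∞)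
          (X.birth ω u, X.life u ω') * G.indicator (1 : EuclideanSpace ℝ (Fin n) → ℝ≥0∞)
            (X.birthplace y ω u + X.motion u (t - X.birth ω u).toNNReal ω') ∂P = _ from this]
        by_cases hb : X.birth ω u ≤ t
        · rw [Set.indicator_of_mem (show X.birth ω u ∈ Set.Iic t from hb),
            Set.indicator_of_mem (show X.birth ω u ∈ Set.Iic t from hb),
            expMeasure_Ioi lam hlam (sub_nonneg.2 hb)]
          simp
        · rw [Set.indicator_of_notMem (show X.birth ω u ∉ Set.Iic t from hb),
            Set.indicator_of_notMem (show X.birth ω u ∉ Set.Iic t from hb)]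
          simp
      · refine ne_top_of_le_ne_top ENNReal.one_ne_top ?_
        exact Set.indicator_le_self' (by simp) _
  rw [expectedNumber]
  simp_rw [X.count_eq_tsum]
  rw [lintegral_tsum fun u : {u : List ℕ // u.length = k} => (measurable_one.indicator
    (X.measurableSet_alive_position hG y u.1 t)).aemeasurable]
  simp_rw [fun u : {u : List ℕ // u.length = k} =>
    lintegral_indicator_one (μ := P) (X.measurableSet_alive_position hG y u t), key]
  rw [X.tsum_lintegral_producedInd hlam hB y k hhm,
    ← lintegral_erlangMeasure_survival lam hlam k t ht, ← lintegral_mul_const _ hsurv]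
  congr 1
  refine lintegral_congr_ae ?_
  filter_upwards [ae_nonneg_erlangMeasure lam k] with b hb
  simp only [hh]
  by_cases hbt : b ≤ t
  · rw [Set.indicator_of_mem (show b ∈ Set.Iic t from hbt), heat,
      lintegral_const_mul' _ _ ENNReal.ofReal_ne_top]
    congr 1
    -- The displacement up to birth and the one since birth add up to a displacement of duration
    -- `t`; the location factor loses its dependence on `b`.
    have := X.heat_heat b.toNNReal (t - b).toNNReal (g := fun w => G.indicator 1 (y + w))
      (hGm.comp (measurable_const_add y))
    rw [← Real.toNNReal_add hb (sub_nonneg.2 hbt), add_sub_cancel] at this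
    rw [← this]
    simp only [heat, add_assoc]
  · rw [Set.indicator_of_notMem (show b ∉ Set.Iic t from hbt)]
    simp [heat]

end BranchingDiffusion

/-! ### Differentiating the moment generating series at zero -/

/-- Convexity of the exponential bounds the difference quotient by `x` for `s < 0` and by the slope
at `s` for `s > 0`; at `s = 0` the inverse is `0`. The majorant is uniform in `s ≤ r`. -/
theorem abs_exp_sub_one_div_le {s r x : ℝ} (hx : 0 ≤ x) (hr : 0 ≤ r) (hsr : s ≤ r) :
    |s⁻¹ * (Real.exp (s * x) - 1)| ≤ x * Real.exp (r * x) := by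
  have h1 : x ≤ x * Real.exp (r * x) := le_mul_of_one_le_right hx (Real.one_le_exp (by positivity))
  rcases lt_trichotomy s 0 with hs | rfl | hs
  · have h2 : Real.exp (s * x) ≤ 1 := Real.exp_le_one_iff.2 (mul_nonpos_of_nonpos_of_nonneg hs.le hx)
    have h3 := Real.add_one_le_exp (s * x)
    rw [abs_of_nonneg (mul_nonneg_of_nonpos_of_nonpos (inv_nonpos.2 hs.le) (by linarith))]
    refine le_trans ?_ h1
    calc s⁻¹ * (Real.exp (s * x) - 1) ≤ s⁻¹ * (s * x) :=
          mul_le_mul_of_nonpos_left (by linarith) (inv_nonpos.2 hs.le)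
      _ = x := inv_mul_cancel_left₀ hs.ne x
  · simpa using hx.trans h1
  · have h2 : 1 ≤ Real.exp (s * x) := Real.one_le_exp (by positivity)
    have h3 := Real.add_one_le_exp (-(s * x))
    have h4 : Real.exp (s * x) - 1 ≤ s * x * Real.exp (s * x) := by
      have := mul_le_mul_of_nonneg_right h3 (Real.exp_pos (s * x)).le
      rw [← Real.exp_add] at this
      simp at this
      linarith
    have h5 : Real.exp (s * x) ≤ Real.exp (r * x) := Real.exp_le_exp.2 (by gcongr)
    rw [abs_of_nonneg (mul_nonneg (inv_nonneg.2 hs.le) (by linarith)), inv_mul_le_iff₀ hs]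
    calc _ ≤ s * x * Real.exp (s * x) := h4
      _ ≤ s * x * Real.exp (r * x) := by gcongr
      _ = _ := by ring

/-- The moment generating series is differentiable at `0` within its domain of convergence as soon
as the mean is finite. -/
theorem hasDerivWithinAt_tsum_mul_exp {q : ℕ → ℝ} {m : ℝ} (hq : ∀ i, 0 ≤ q i) (h0 : Summable q)
    (h1 : HasSum (fun i : ℕ => (i : ℝ) * q i) m) :
    HasDerivWithinAt (fun s : ℝ => ∑' i : ℕ, q i * Real.exp (s * i)) m
      {s | Summable fun i : ℕ => q i * Real.exp (s * i)} 0 := by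
  set S : Set ℝ := {s | Summable fun i : ℕ => q i * Real.exp (s * i)} with hS
  -- If the domain contains some `s₁ > 0`, half of that exponent pays for the factor `i`, by `1 + x
  -- ≤ exp x`, and `r = s₁ / 2` works. Otherwise the domain lies in `s ≤ 0`, and `r = 0` works
  -- because the mean is finite.
  obtain ⟨r, hr, hsum, hev⟩ : ∃ r : ℝ, 0 ≤ r ∧
      (Summable fun i : ℕ => q i * (i * Real.exp (r * i))) ∧ ∀ᶠ s in 𝓝[S \ {0}] 0, s ≤ r := by
    by_cases h : ∃ s₁ ∈ S, 0 < s₁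
    · obtain ⟨s₁, hs₁, hpos⟩ := h
      refine ⟨s₁ / 2, by positivity, ?_, ?_⟩
      · refine Summable.of_nonneg_of_le (fun i => by have := hq i; positivity) (fun i => ?_)
          (Summable.mul_left (2 / s₁) hs₁)
        have h2 := Real.add_one_le_exp (s₁ / 2 * i)
        have h3 : (i : ℝ) ≤ 2 / s₁ * Real.exp (s₁ / 2 * i) := by
          rw [div_mul_eq_mul_div, le_div_iff₀ hpos]
          linarith
        have h4 : Real.exp (s₁ * i) = Real.exp (s₁ / 2 * i) * Real.exp (s₁ / 2 * i) := by
          rw [← Real.exp_add]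
          ring_nf
        rw [h4]
        have h5 := mul_le_mul_of_nonneg_right h3 (Real.exp_pos (s₁ / 2 * i)).le
        have := mul_le_mul_of_nonneg_left h5 (hq i)
        linarith
      · exact mem_nhdsWithin_of_mem_nhds (Iic_mem_nhds (by positivity))
    · push Not at h
      refine ⟨0, le_rfl, ?_, ?_⟩
      · simpa [mul_comm] using h1.summable
      · filter_upwards [self_mem_nhdsWithin] with s hs using h s hs.1
  rw [hasDerivWithinAt_iff_tendsto_slope]
  have hlim : Tendsto (fun s : ℝ => ∑' i : ℕ, q i * (s⁻¹ * (Real.exp (s * i) - 1)))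
      (𝓝[S \ {0}] 0) (𝓝 (∑' i : ℕ, q i * i)) := by
    refine tendsto_tsum_of_dominated_convergence hsum (fun i => ?_) ?_
    · refine Tendsto.const_mul _ ?_
      have hd : HasDerivAt (fun s : ℝ => Real.exp (s * i)) i 0 := by
        have := ((hasDerivAt_id (0 : ℝ)).mul_const (i : ℝ)).exp
        simpa using this
      rw [hasDerivAt_iff_tendsto_slope] at hd
      refine (hd.mono_left (nhdsWithin_mono _ fun s hs => hs.2)).congr fun s => ?_
      simp [slope_def_field, div_eq_inv_mul]
    · filter_upwards [hev] with s hs i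
      rw [norm_mul, Real.norm_of_nonneg (hq i)]
      exact mul_le_mul_of_nonneg_left (abs_exp_sub_one_div_le (Nat.cast_nonneg i) hr hs) (hq i)
  have hm : ∑' i : ℕ, q i * i = m := by
    rw [← h1.tsum_eq]
    exact tsum_congr fun i => mul_comm _ _
  rw [hm] at hlim
  refine hlim.congr' ?_
  filter_upwards [self_mem_nhdsWithin] with s hs
  have hs1 : Summable fun i : ℕ => q i * Real.exp (s * i) := hs.1
  rw [slope_def_field]
  simp only [zero_mul, Real.exp_zero, mul_one, sub_zero]
  rw [← hs1.tsum_sub h0, div_eq_inv_mul, ← tsum_mul_left]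
  exact tsum_congr fun i => by ring

/-- A finite expectation makes `c` finite almost surely, so the level sets at natural numbers
exhaust the expectation and nothing is lost at `⊤`. -/
theorem tsum_measureReal_enat_eq {Ω : Type*} [MeasurableSpace Ω] {P : Measure Ω}
    [IsProbabilityMeasure P] {c : Ω → ℕ∞} (hc : Measurable fun ω => (c ω : ℝ≥0∞))
    (hfin : ∫⁻ ω, (c ω : ℝ≥0∞) ∂P ≠ ∞) :
    (Summable fun i : ℕ => P.real {ω | c ω = i}) ∧
      HasSum (fun i : ℕ => (i : ℝ) * P.real {ω | c ω = i}) (∫⁻ ω, (c ω : ℝ≥0∞) ∂P).toReal := by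
  have hset : ∀ i : ℕ, MeasurableSet {ω | c ω = i} := fun i => by
    have : {ω | c ω = i} = (fun ω => (c ω : ℝ≥0∞)) ⁻¹' {(i : ℝ≥0∞)} := by
      ext ω
      simp [← ENat.toENNReal_coe]
    rw [this]
    exact hc (measurableSet_singleton _)
  have hdisj : Pairwise (Function.onFun Disjoint fun i : ℕ => {ω | c ω = i}) := fun i j hij =>
    Set.disjoint_left.2 fun ω hi hj => hij (by
      have hi' : c ω = i := hi
      have hj' : c ω = j := hj
      exact_mod_cast hi'.symm.trans hj')
  constructor
  · refine ENNReal.summable_toReal ?_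
    rw [← measure_iUnion hdisj hset]
    exact measure_ne_top _ _
  · have htop : ∀ᵐ ω ∂P, (c ω : ℝ≥0∞) < ∞ := ae_lt_top hc hfin
    have e : ∫⁻ ω, (c ω : ℝ≥0∞) ∂P = ∑' i : ℕ, (i : ℝ≥0∞) * P {ω | c ω = i} := by
      have : ∫⁻ ω, (c ω : ℝ≥0∞) ∂P
          = ∫⁻ ω, ∑' i : ℕ, Set.indicator {ω | c ω = i} (fun _ => (i : ℝ≥0∞)) ω ∂P := by
        refine lintegral_congr_ae ?_
        filter_upwards [htop] with ω hω
        obtain ⟨j, hj⟩ : ∃ j : ℕ, c ω = j := by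
          have : c ω ≠ ⊤ := fun h => by simp [h] at hω
          exact ⟨(c ω).toNat, (ENat.natCast_toNat this).symm⟩
        rw [tsum_eq_single j, Set.indicator_of_mem (show ω ∈ {ω | c ω = j} from hj), hj]
        · simp
        · intro i hi
          refine Set.indicator_of_notMem (fun h => hi ?_) _
          have h' : c ω = i := h
          exact_mod_cast h'.symm.trans hj
      rw [this, lintegral_tsum fun i => (measurable_const.indicator (hset i)).aemeasurable]
      exact tsum_congr fun i => lintegral_indicator_const (hset i) _
    rw [e] at hfin ⊢
    have := ENNReal.hasSum_toReal hfin
    rw [ENNReal.tsum_toReal_eq fun i => ENNReal.ne_top_of_tsum_ne_top hfin i]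
    simpa [Measure.real, ENNReal.toReal_mul] using (ENNReal.summable_toReal hfin).hasSum

namespace BranchingDiffusion

variable {n : ℕ} {D lam : ℝ} {p : PMF ℕ} {Ω : Type*} [mΩ : MeasurableSpace Ω] {P : Measure Ω}
  (X : BranchingDiffusion n D lam p P)

theorem hasDerivWithinAt_momentGen [IsProbabilityMeasure P] (k : ℕ)
    {G : Set (EuclideanSpace ℝ (Fin n))} (hG : MeasurableSet G) (y : EuclideanSpace ℝ (Fin n))
    (t : ℝ) (hfin : X.expectedNumber k G y t ≠ ∞) :
    HasDerivWithinAt (X.momentGen k G y t) (X.expectedNumber k G y t).toReal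
      (X.momentGenDomain k G y t) 0 ∧ Set.Iic 0 ⊆ X.momentGenDomain k G y t := by
  obtain ⟨h0, h1⟩ := tsum_measureReal_enat_eq (X.measurable_count hG k y t) hfin
  refine ⟨hasDerivWithinAt_tsum_mul_exp (fun i => measureReal_nonneg) h0 h1, fun s hs => ?_⟩
  refine Summable.of_nonneg_of_le
    (fun i => mul_nonneg measureReal_nonneg (Real.exp_pos _).le) (fun i => ?_) h0
  exact mul_le_of_le_one_right measureReal_nonneg
    (Real.exp_le_one_iff.2 (mul_nonpos_of_nonpos_of_nonneg hs (Nat.cast_nonneg i)))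

theorem heat_zero [IsProbabilityMeasure P] (g : EuclideanSpace ℝ (Fin n) → ℝ≥0∞) :
    X.heat 0 g = g 0 := by
  simp [heat, (X.isDiffusion_motion []).zero]

theorem map_motion_eq_withDensity {t : ℝ} (ht : 0 < t) :
    P.map (X.motion [] t.toNNReal)
      = volume.withDensity fun x => ENNReal.ofReal (diffusionDensity D x 0 t) := by
  have := (X.isDiffusion_motion []).law 0 t.toNNReal (Real.toNNReal_pos.2 ht)
  simpa [(X.isDiffusion_motion []).zero, ht.le] using this

end BranchingDiffusion

/-! ### The diffusion density as a law: total mass and weak limit -/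

theorem diffusionDensity_add_left {n : ℕ} (D : ℝ) (w y : EuclideanSpace ℝ (Fin n)) (t : ℝ) :
    diffusionDensity D (y + w) y t = diffusionDensity D w 0 t := by
  simp [diffusionDensity]

theorem diffusionDensity_nonneg {n : ℕ} {D : ℝ} (hD : 0 < D) (x y : EuclideanSpace ℝ (Fin n))
    {t : ℝ} (ht : 0 < t) : 0 ≤ diffusionDensity D x y t := by
  have := Real.pi_pos
  unfold diffusionDensity
  positivity

theorem continuous_diffusionDensity {n : ℕ} (D : ℝ) (y : EuclideanSpace ℝ (Fin n)) (t : ℝ) :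
    Continuous fun x => diffusionDensity D x y t := by
  unfold diffusionDensity
  fun_prop

namespace BranchingDiffusion

variable {n : ℕ} {D lam : ℝ} {p : PMF ℕ} {Ω : Type*} [mΩ : MeasurableSpace Ω] {P : Measure Ω}

theorem heat_add_eq_lintegral (X : BranchingDiffusion n D lam p P) {t : ℝ} (ht : 0 < t) (y : EuclideanSpace ℝ (Fin n))
    {g : EuclideanSpace ℝ (Fin n) → ℝ≥0∞} (hg : Measurable g) :
    X.heat t.toNNReal (fun w => g (y + w))
      = ∫⁻ x, ENNReal.ofReal (diffusionDensity D x y t) * g x := by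
  have hg' : Measurable fun w => g (y + w) := hg.comp (measurable_const_add y)
  rw [heat, ← lintegral_map hg' (X.measurable_motion [] _), X.map_motion_eq_withDensity ht,
    lintegral_withDensity_eq_lintegral_mul _
      (continuous_diffusionDensity D 0 t).measurable.ennreal_ofReal hg',
    ← lintegral_add_left_eq_self (fun x => ENNReal.ofReal (diffusionDensity D x y t) * g x) y]
  simp only [Pi.mul_apply, diffusionDensity_add_left]

/-- No Gaussian integral is computed: the density is that of a displacement under a probability
measure, so its mass is one. -/
theorem lintegral_diffusionDensity [IsProbabilityMeasure P]
    (X : BranchingDiffusion n D lam p P) {t : ℝ} (ht : 0 < t)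
    (y : EuclideanSpace ℝ (Fin n)) :
    ∫⁻ x, ENNReal.ofReal (diffusionDensity D x y t) = 1 := by
  have := X.heat_add_eq_lintegral ht y (g := fun _ => 1) measurable_const
  simp only [mul_one] at this
  rw [← this]
  simp [heat]

theorem integrable_diffusionDensity [IsProbabilityMeasure P]
    (X : BranchingDiffusion n D lam p P) (hD : 0 < D) {t : ℝ} (ht : 0 < t)
    (y : EuclideanSpace ℝ (Fin n)) : Integrable fun x => diffusionDensity D x y t := by
  refine ⟨(continuous_diffusionDensity D y t).aestronglyMeasurable, ?_⟩
  rw [hasFiniteIntegral_iff_ofReal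
    (Eventually.of_forall fun x => diffusionDensity_nonneg hD x y ht),
    X.lintegral_diffusionDensity ht y]
  exact ENNReal.one_lt_top

theorem integral_diffusionDensity [IsProbabilityMeasure P]
    (X : BranchingDiffusion n D lam p P) (hD : 0 < D) {t : ℝ} (ht : 0 < t)
    (y : EuclideanSpace ℝ (Fin n)) : ∫ x, diffusionDensity D x y t = 1 := by
  rw [integral_eq_lintegral_of_nonneg_ae
    (Eventually.of_forall fun x => diffusionDensity_nonneg hD x y ht)
    (continuous_diffusionDensity D y t).aestronglyMeasurable, X.lintegral_diffusionDensity ht y]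
  simp

theorem integral_mul_diffusionDensity [IsProbabilityMeasure P]
    (X : BranchingDiffusion n D lam p P) (hD : 0 < D) {t : ℝ} (ht : 0 < t)
    (y : EuclideanSpace ℝ (Fin n)) (f : EuclideanSpace ℝ (Fin n) →ᵇ ℝ) :
    ∫ x, f x * diffusionDensity D x y t = ∫ ω, f (y + X.motion [] t.toNNReal ω) ∂P := by
  have hf : Continuous fun w => f (y + w) := f.continuous.comp (continuous_const_add y)
  rw [← integral_map (X.measurable_motion [] _).aemeasurable hf.aestronglyMeasurable,
    X.map_motion_eq_withDensity ht, integral_withDensity_eq_integral_toReal_smul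
      (continuous_diffusionDensity D 0 t).measurable.ennreal_ofReal
      (Eventually.of_forall fun x => ENNReal.ofReal_lt_top),
    ← integral_add_left_eq_self (fun x => f x * diffusionDensity D x y t) y]
  refine integral_congr_ae (Eventually.of_forall fun w => ?_)
  simp only [diffusionDensity_add_left, smul_eq_mul]
  rw [ENNReal.toReal_ofReal (diffusionDensity_nonneg hD w 0 ht), mul_comm]

/-- Written as an expectation over paths, the limit is dominated convergence along continuous paths
that start at the origin. -/
theorem tendsto_integral_mul_diffusionDensity [IsProbabilityMeasure P]
    (X : BranchingDiffusion n D lam p P) (hD : 0 < D)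
    (y : EuclideanSpace ℝ (Fin n)) (f : EuclideanSpace ℝ (Fin n) →ᵇ ℝ) :
    Tendsto (fun t => ∫ x, f x * diffusionDensity D x y t) (𝓝[>] 0) (𝓝 (f y)) := by
  have h : Tendsto (fun t : ℝ => ∫ ω, f (y + X.motion [] t.toNNReal ω) ∂P) (𝓝[>] 0)
      (𝓝 (∫ _, f y ∂P)) := by
    refine tendsto_integral_filter_of_dominated_convergence (fun _ => ‖f‖)
      (Eventually.of_forall fun t => ?_)
      (Eventually.of_forall fun t => Eventually.of_forall fun ω => f.norm_coe_le_norm _)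
      (integrable_const _) (Eventually.of_forall fun ω => ?_)
    · exact (f.continuous.measurable.comp
        ((X.measurable_motion [] _).const_add y)).aestronglyMeasurable
    · have hc : Continuous fun t : ℝ => f (y + X.motion [] t.toNNReal ω) :=
        f.continuous.comp (continuous_const.add
          (((X.isDiffusion_motion []).continuous ω).comp continuous_real_toNNReal))
      have := hc.tendsto 0
      simp only [Real.toNNReal_zero, (X.isDiffusion_motion []).zero, add_zero] at this
      exact this.mono_left nhdsWithin_le_nhds
  simp only [integral_const, probReal_univ, one_smul] at h
  refine h.congr' ?_
  filter_upwards [self_mem_nhdsWithin] with t ht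
  exact (X.integral_mul_diffusionDensity hD ht y f).symm

end BranchingDiffusion

/-! ### The Gaussian and the heat equation -/

/-- The Laplacian as the sum of the pure second partial derivatives. -/
theorem laplacian_eq_sum_fderiv {n : ℕ} {f : EuclideanSpace ℝ (Fin n) → ℝ}
    {x : EuclideanSpace ℝ (Fin n)} (hf : ContDiffAt ℝ 2 f x) :
    Laplacian.laplacian f x = ∑ i, fderiv ℝ
      (fun z => fderiv ℝ f z (EuclideanSpace.basisFun (Fin n) ℝ i)) x
        (EuclideanSpace.basisFun (Fin n) ℝ i) := by
  rw [InnerProductSpace.laplacian_eq_iteratedFDeriv_orthonormalBasis f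
    (EuclideanSpace.basisFun (Fin n) ℝ)]
  have hd : DifferentiableAt ℝ (fderiv ℝ f) x :=
    (hf.fderiv_right (m := 1) (by norm_num)).differentiableAt (by norm_num)
  refine Finset.sum_congr rfl fun i _ => ?_
  rw [iteratedFDeriv_two_apply, fderiv_clm_apply hd (differentiableAt_const _)]
  simp

theorem contDiff_gaussian {n : ℕ} (a : ℝ) (y : EuclideanSpace ℝ (Fin n)) :
    ContDiff ℝ 2 fun z => Real.exp (-a * ‖z - y‖ ^ 2) :=
  Real.contDiff_exp.comp (contDiff_const.mul ((contDiff_id.sub contDiff_const).norm_sq ℝ))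

theorem fderiv_gaussian_apply {n : ℕ} (a : ℝ) (y z e : EuclideanSpace ℝ (Fin n)) :
    fderiv ℝ (fun z => Real.exp (-a * ‖z - y‖ ^ 2)) z e
      = -2 * a * inner ℝ (z - y) e * Real.exp (-a * ‖z - y‖ ^ 2) := by
  have h : HasFDerivAt (fun z : EuclideanSpace ℝ (Fin n) => ‖z - y‖ ^ 2)
      (2 • (innerSL ℝ (z - y)).comp (ContinuousLinearMap.id ℝ _)) z :=
    ((hasFDerivAt_id z).sub_const y).norm_sq
  rw [((h.const_mul (-a)).exp).fderiv]
  simp only [smul_apply, smul_eq_mul, ContinuousLinearMap.comp_id, innerSL_apply_apply, nsmul_eq_mul]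
  push_cast
  ring

theorem laplacian_gaussian {n : ℕ} (a : ℝ) (x y : EuclideanSpace ℝ (Fin n)) :
    Laplacian.laplacian (fun z => Real.exp (-a * ‖z - y‖ ^ 2)) x
      = (4 * a ^ 2 * ‖x - y‖ ^ 2 - 2 * a * n) * Real.exp (-a * ‖x - y‖ ^ 2) := by
  rw [laplacian_eq_sum_fderiv (contDiff_gaussian a y).contDiffAt]
  have e : ∀ i, fderiv ℝ (fun z => fderiv ℝ (fun z => Real.exp (-a * ‖z - y‖ ^ 2)) z
      (EuclideanSpace.basisFun (Fin n) ℝ i)) x (EuclideanSpace.basisFun (Fin n) ℝ i)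
      = (4 * a ^ 2 * (inner ℝ (x - y) (EuclideanSpace.basisFun (Fin n) ℝ i)) ^ 2 - 2 * a)
        * Real.exp (-a * ‖x - y‖ ^ 2) := fun i => by
    set v := EuclideanSpace.basisFun (Fin n) ℝ i with hv
    have hv1 : inner ℝ v v = (1 : ℝ) := by
      rw [real_inner_self_eq_norm_sq, hv, OrthonormalBasis.norm_eq_one]
      norm_num
    have h1 : HasFDerivAt (fun z : EuclideanSpace ℝ (Fin n) => -2 * a * inner ℝ (z - y) v)
        ((-2 * a) • (innerSL ℝ v)) x := by
      refine HasFDerivAt.const_mul ?_ _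
      have := (innerSL ℝ v).hasFDerivAt.comp x ((hasFDerivAt_id x).sub_const y)
      refine this.congr_of_eventuallyEq (Eventually.of_forall fun z => ?_)
      simp [real_inner_comm]
    have h2 := ((contDiff_gaussian a y).differentiable (by norm_num) x).hasFDerivAt
    have h3 : (fun z => fderiv ℝ (fun z => Real.exp (-a * ‖z - y‖ ^ 2)) z v)
        = fun z => -2 * a * inner ℝ (z - y) v * Real.exp (-a * ‖z - y‖ ^ 2) :=
      funext fun z => fderiv_gaussian_apply a y z v
    have h4 : HasFDerivAt
        (fun z => -2 * a * inner ℝ (z - y) v * Real.exp (-a * ‖z - y‖ ^ 2)) _ x := h1.mul h2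
    rw [h3, h4.fderiv]
    simp only [add_apply, smul_apply, smul_eq_mul, fderiv_gaussian_apply, innerSL_apply_apply, hv1]
    ring
  simp_rw [e]
  rw [← Finset.sum_mul, Finset.sum_sub_distrib, ← Finset.mul_sum]
  -- Parseval: the squared coordinates of `x - y` add up to its squared norm, while the `n` constant
  -- terms give the dimension.
  have := (EuclideanSpace.basisFun (Fin n) ℝ).sum_sq_norm_inner_left (x - y)
  simp only [Real.norm_eq_abs, sq_abs] at this
  rw [this]
  simp
  ring_nf

theorem diffusionDensity_eq_gaussian {n : ℕ} (D : ℝ) (x y : EuclideanSpace ℝ (Fin n)) (t : ℝ) :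
    diffusionDensity D x y t = (4 * Real.pi * D * t) ^ (-(n : ℝ) / 2) *
      Real.exp (-(1 / (4 * D * t)) * ‖x - y‖ ^ 2) := by
  rw [diffusionDensity]
  congr 2
  ring

theorem contDiff_diffusionDensity {n : ℕ} (D : ℝ) (y : EuclideanSpace ℝ (Fin n)) (t : ℝ) :
    ContDiff ℝ 2 fun x => diffusionDensity D x y t := by
  simp_rw [diffusionDensity_eq_gaussian]
  exact contDiff_const.mul (contDiff_gaussian _ y)

theorem laplacian_const_mul {n : ℕ} {f : EuclideanSpace ℝ (Fin n) → ℝ} (hf : ContDiff ℝ 2 f)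
    (c : ℝ) (x : EuclideanSpace ℝ (Fin n)) :
    Laplacian.laplacian (fun z => c * f z) x = c * Laplacian.laplacian f x :=
  InnerProductSpace.laplacian_smul c hf.contDiffAt

/-- The diffusion density solves the heat equation. -/
theorem hasDerivAt_diffusionDensity {n : ℕ} {D : ℝ} (hD : 0 < D)
    (x y : EuclideanSpace ℝ (Fin n)) {t : ℝ} (ht : 0 < t) :
    HasDerivAt (fun s => diffusionDensity D x y s)
      (D * Laplacian.laplacian (fun x' => diffusionDensity D x' y t) x) t := by
  have hpi := Real.pi_pos
  have hpos : 0 < 4 * Real.pi * D * t := by positivity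
  simp_rw [fun x' => diffusionDensity_eq_gaussian D x' y t]
  rw [laplacian_const_mul (contDiff_gaussian _ y), laplacian_gaussian]
  have h1 : HasDerivAt (fun s => (4 * Real.pi * D * s) ^ (-(n : ℝ) / 2))
      (4 * Real.pi * D * 1 * (-(n : ℝ) / 2) * (4 * Real.pi * D * t) ^ (-(n : ℝ) / 2 - 1)) t :=
    ((hasDerivAt_id t).const_mul (4 * Real.pi * D)).rpow_const (Or.inl hpos.ne')
  have h2 : HasDerivAt (fun s => -‖x - y‖ ^ 2 / (4 * D * s))
      ((0 * (4 * D * t) - (-‖x - y‖ ^ 2) * (4 * D * 1)) / (4 * D * t) ^ 2) t :=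
    (hasDerivAt_const t _).div ((hasDerivAt_id t).const_mul (4 * D)) (by positivity)
  refine (h1.mul h2.exp).congr_deriv ?_
  rw [Real.rpow_sub_one hpos.ne']
  have e : Real.exp (-(1 / (4 * D * t)) * ‖x - y‖ ^ 2) = Real.exp (-‖x - y‖ ^ 2 / (4 * D * t)) := by
    congr 1
    ring
  rw [e]
  field_simp
  ring

theorem contDiffOn_diffusionDensity {n : ℕ} {D : ℝ} (hD : 0 < D)
    (y : EuclideanSpace ℝ (Fin n)) :
    ContDiffOn ℝ 2 (fun q : EuclideanSpace ℝ (Fin n) × ℝ => diffusionDensity D q.1 y q.2)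
      (Set.univ ×ˢ Set.Ioi 0) := by
  have hpi := Real.pi_pos
  have hs : ContDiffOn ℝ 2 (fun q : EuclideanSpace ℝ (Fin n) × ℝ => 4 * Real.pi * D * q.2)
      (Set.univ ×ˢ Set.Ioi 0) := (contDiff_const.mul contDiff_snd).contDiffOn
  have hs' : ContDiffOn ℝ 2 (fun q : EuclideanSpace ℝ (Fin n) × ℝ => 4 * D * q.2)
      (Set.univ ×ˢ Set.Ioi 0) := (contDiff_const.mul contDiff_snd).contDiffOn
  have hx : ContDiffOn ℝ 2 (fun q : EuclideanSpace ℝ (Fin n) × ℝ => -‖q.1 - y‖ ^ 2)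
      (Set.univ ×ˢ Set.Ioi 0) :=
    ((contDiff_fst.sub contDiff_const).norm_sq ℝ).neg.contDiffOn
  have hpos : ∀ q ∈ (Set.univ ×ˢ Set.Ioi 0 : Set (EuclideanSpace ℝ (Fin n) × ℝ)), 0 < q.2 :=
    fun q hq => hq.2
  unfold diffusionDensity
  refine ContDiffOn.mul (hs.rpow_const_of_ne fun q hq => ?_) (ContDiffOn.exp (hx.div hs' fun q hq => ?_))
  · have := hpos q hq
    positivity
  · have := hpos q hq
    positivity

/-! ### The explicit densities and the recursive system -/

/-- The first moment densities of the branching diffusion. -/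
def momentDensity {n : ℕ} (D lam B : ℝ) (k : ℕ) (x y : EuclideanSpace ℝ (Fin n)) (t : ℝ) : ℝ :=
  if 0 < t then
    (lam * B * t) ^ k / k.factorial * (Real.exp (-lam * t) * diffusionDensity D x y t)
  -- This value serves `t = 0` with `k ≥ 1`: it is both the prescribed initial value and a density
  -- of the zero expected number.
  else 0

theorem momentDensity_of_pos {n : ℕ} (D lam B : ℝ) (k : ℕ) (x y : EuclideanSpace ℝ (Fin n))
    {t : ℝ} (ht : 0 < t) : momentDensity D lam B k x y t
      = (lam * B * t) ^ k / k.factorial * (Real.exp (-lam * t) * diffusionDensity D x y t) :=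
  if_pos ht

/-- The product rule produces the three terms: differentiating the power over `k!` gives `lam * B`
times the same expression for `k - 1`, the exponential gives the killing, and the Gaussian gives the
diffusion. -/
theorem hasDerivAt_momentDensity {n : ℕ} {D : ℝ} (hD : 0 < D) (lam B : ℝ) {k : ℕ} (hk : 1 ≤ k)
    (x y : EuclideanSpace ℝ (Fin n)) {t : ℝ} (ht : 0 < t) :
    HasDerivAt (fun s => momentDensity D lam B k x y s)
      (D * Laplacian.laplacian (fun x' => momentDensity D lam B k x' y t) x
        - lam * momentDensity D lam B k x y t
        + lam * B * momentDensity D lam B (k - 1) x y t) t := by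
  obtain ⟨j, rfl⟩ : ∃ j, k = j + 1 := ⟨k - 1, by omega⟩
  have hev : (fun s => momentDensity D lam B (j + 1) x y s) =ᶠ[𝓝 t] fun s =>
      (lam * B * s) ^ (j + 1) / (j + 1).factorial *
        (Real.exp (-lam * s) * diffusionDensity D x y s) := by
    filter_upwards [Ioi_mem_nhds ht] with s hs using momentDensity_of_pos _ _ _ _ _ _ hs
  refine HasDerivAt.congr_of_eventuallyEq ?_ hev
  simp_rw [fun k x' => momentDensity_of_pos D lam B k x' y ht]
  rw [laplacian_const_mul (contDiff_const.mul (contDiff_diffusionDensity D y t)),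
    laplacian_const_mul (contDiff_diffusionDensity D y t)]
  have h1 : HasDerivAt (fun s => (lam * B * s) ^ (j + 1) / ((j + 1).factorial : ℝ))
      (((j + 1 : ℕ) : ℝ) * (lam * B * t) ^ j * (lam * B * 1) / ((j + 1).factorial : ℝ)) t :=
    (((hasDerivAt_id t).const_mul (lam * B)).pow (j + 1)).div_const _
  have h2 : HasDerivAt (fun s => Real.exp (-lam * s)) (Real.exp (-lam * t) * (-lam * 1)) t :=
    ((hasDerivAt_id t).const_mul (-lam)).exp
  refine (h1.mul (h2.mul (hasDerivAt_diffusionDensity hD x y ht))).congr_deriv ?_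
  simp only [Nat.factorial_succ, Nat.add_sub_cancel, Pi.mul_apply]
  push_cast
  have : (j.factorial : ℝ) ≠ 0 := by positivity
  field_simp
  ring

theorem solvesMomentSystem_momentDensity {n : ℕ} {D lam B : ℝ} (hD : 0 < D) (hlam : 0 < lam)
    {p : PMF ℕ} {Ω : Type*} [MeasurableSpace Ω] {P : Measure Ω} [IsProbabilityMeasure P]
    (X : BranchingDiffusion n D lam p P) (y : EuclideanSpace ℝ (Fin n)) :
    SolvesMomentSystem D lam B y (fun k x t => momentDensity D lam B k x y t) := by
  -- The power of zero is kept so that one limit covers both initial conditions: it is `1` for `k =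
  -- 0` and `0` for `k ≥ 1`.
  have hlim : ∀ (k : ℕ) (f : EuclideanSpace ℝ (Fin n) →ᵇ ℝ),
      Tendsto (fun t => ∫ x, f x * momentDensity D lam B k x y t) (𝓝[>] 0)
        (𝓝 ((lam * B * 0) ^ k / k.factorial * (Real.exp (-lam * 0) * f y))) := fun k f => by
    have h1 : Tendsto (fun t => (lam * B * t) ^ k / k.factorial) (𝓝[>] 0)
        (𝓝 ((lam * B * 0) ^ k / (k.factorial : ℝ))) :=
      ((by fun_prop : Continuous fun t : ℝ => (lam * B * t) ^ k / (k.factorial : ℝ)).tendsto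
        0).mono_left nhdsWithin_le_nhds
    have h2 : Tendsto (fun t => Real.exp (-lam * t)) (𝓝[>] 0) (𝓝 (Real.exp (-lam * 0))) :=
      ((by fun_prop : Continuous fun t : ℝ => Real.exp (-lam * t)).tendsto
        0).mono_left nhdsWithin_le_nhds
    refine (h1.mul (h2.mul (X.tendsto_integral_mul_diffusionDensity hD y f))).congr' ?_
    filter_upwards [self_mem_nhdsWithin] with t ht
    rw [← integral_const_mul, ← integral_const_mul]
    refine integral_congr_ae (Eventually.of_forall fun x => ?_)
    simp only [momentDensity_of_pos D lam B k x y ht]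
    ring
  refine ⟨fun x t ht => ?_, fun f => ?_, fun k _ => ?_, fun k hk x t ht => ?_, fun k _ t ht => ?_,
    fun k _ T hT => ?_, fun k _ x => ?_, fun k hk f => ?_⟩
  · simp [momentDensity_of_pos D lam B 0 x y ht]
  · simpa using hlim 0 f
  · have h : ContDiffOn ℝ 2 (fun q : EuclideanSpace ℝ (Fin n) × ℝ =>
        (lam * B * q.2) ^ k / (k.factorial : ℝ) *
          (Real.exp (-lam * q.2) * diffusionDensity D q.1 y q.2)) (Set.univ ×ˢ Set.Ioi 0) := by
      refine ContDiffOn.mul ?_ (ContDiffOn.mul ?_ (contDiffOn_diffusionDensity hD y))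
      · exact (((contDiff_const.mul contDiff_snd).pow k).div_const _).contDiffOn
      · exact (contDiff_const.mul contDiff_snd).exp.contDiffOn
    exact h.congr fun q hq => momentDensity_of_pos D lam B k q.1 y hq.2
  · exact hasDerivAt_momentDensity hD lam B hk x y ht
  · simp_rw [fun x => momentDensity_of_pos D lam B k x y ht]
    exact ((X.integrable_diffusionDensity hD ht y).const_mul _).const_mul _
  · refine ⟨(|lam * B| * T) ^ k / k.factorial, fun t ht htT => ?_⟩
    have e : ∀ a b c : ℝ, |a * (b * c)| = |a| * (|b| * |c|) := fun a b c => by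
      rw [abs_mul, abs_mul]
    simp_rw [fun x => momentDensity_of_pos D lam B k x y ht, e,
      fun x => abs_of_nonneg (diffusionDensity_nonneg hD x y ht)]
    rw [integral_const_mul, integral_const_mul, X.integral_diffusionDensity hD ht y, mul_one,
      abs_div, abs_pow, Nat.abs_cast, abs_mul (lam * B) t, abs_of_pos ht, Real.abs_exp]
    have h1 : Real.exp (-lam * t) ≤ 1 := by
      rw [Real.exp_le_one_iff]
      nlinarith
    calc (|lam * B| * t) ^ k / k.factorial * Real.exp (-lam * t)
        ≤ (|lam * B| * t) ^ k / k.factorial := mul_le_of_le_one_right (by positivity) h1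
      _ ≤ (|lam * B| * T) ^ k / k.factorial := by gcongr
  · simp [momentDensity]
  · have := hlim k f
    rwa [mul_zero, zero_pow (by omega), zero_div, zero_mul] at this

theorem momentDensity_nonneg {n : ℕ} {D lam B : ℝ} (hD : 0 < D) (hlam : 0 < lam) (hB : 0 ≤ B)
    (k : ℕ) (x y : EuclideanSpace ℝ (Fin n)) (t : ℝ) : 0 ≤ momentDensity D lam B k x y t := by
  rcases lt_or_ge 0 t with ht | ht
  · rw [momentDensity_of_pos _ _ _ _ _ _ ht]
    have := diffusionDensity_nonneg hD x y ht
    positivity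
  · simp [momentDensity, ht.not_gt]

theorem continuous_momentDensity {n : ℕ} (D lam B : ℝ) (k : ℕ) (y : EuclideanSpace ℝ (Fin n))
    (t : ℝ) : Continuous fun x => momentDensity D lam B k x y t := by
  have := continuous_diffusionDensity D y t
  unfold momentDensity
  split_ifs <;> fun_prop

theorem isFirstMomentDensity_momentDensity {n : ℕ} {D lam B : ℝ} (hD : 0 < D) (hlam : 0 < lam)
    {p : PMF ℕ} (hB : HasSum (fun i : ℕ => (i : ℝ) * (p i).toReal) B) {Ω : Type*}
    [MeasurableSpace Ω] {P : Measure Ω} [IsProbabilityMeasure P]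
    (X : BranchingDiffusion n D lam p P) :
    X.IsFirstMomentDensity (momentDensity D lam B) := by
  have hB0 : 0 ≤ B := hB.nonneg fun i => by positivity
  intro k y t ht hkt
  refine ⟨(continuous_momentDensity D lam B k y t).measurable,
    fun x => momentDensity_nonneg hD hlam hB0 k x y t, fun G hG => ?_⟩
  rw [X.expectedNumber_eq hlam hB k hG y ht]
  rcases ht.eq_or_lt with rfl | ht'
  · have hk : k ≠ 0 := by
      rcases hkt with h | h
      · exact (lt_irrefl _ h).elim
      · omega
    simp [momentDensity, hk]
  · have hm : Measurable (G.indicator (1 : EuclideanSpace ℝ (Fin n) → ℝ≥0∞)) :=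
      measurable_one.indicator hG
    rw [X.heat_add_eq_lintegral ht' y hm]
    have e : ∀ x, ENNReal.ofReal (diffusionDensity D x y t) * G.indicator 1 x
        = G.indicator (fun x => ENNReal.ofReal (diffusionDensity D x y t)) x := fun x => by
      by_cases hx : x ∈ G <;> simp [hx]
    simp_rw [e]
    rw [lintegral_indicator hG, ← ENNReal.ofReal_pow hB0, ← mul_assoc,
      ← ENNReal.ofReal_mul (by positivity),
      ← lintegral_const_mul' _ _ ENNReal.ofReal_ne_top]
    refine lintegral_congr fun x => ?_
    rw [← ENNReal.ofReal_mul (by positivity), momentDensity_of_pos _ _ _ _ _ _ ht']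
    congr 1
    rw [neg_mul]
    ring

theorem momentDensity_eq_explicit {n : ℕ} {D : ℝ} (hD : 0 < D) (lam B : ℝ) (k : ℕ)
    (x y : EuclideanSpace ℝ (Fin n)) {t : ℝ} (ht : 0 < t) :
    momentDensity D lam B k x y t
      = (lam * B) ^ k / ((k.factorial : ℝ) * (4 * Real.pi * D) ^ ((n : ℝ) / 2)) *
          t ^ ((k : ℝ) - (n : ℝ) / 2) *
          Real.exp (-lam * t - ‖x - y‖ ^ 2 / (4 * D * t)) := by
  have hpi := Real.pi_pos
  rw [momentDensity_of_pos _ _ _ _ _ _ ht, diffusionDensity,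
    Real.mul_rpow (by positivity) ht.le, neg_div, Real.rpow_neg (by positivity),
    Real.rpow_neg ht.le, Real.rpow_sub ht, Real.rpow_natCast,
    sub_eq_add_neg (-lam * t), Real.exp_add, mul_pow, neg_div]
  field_simp

/-! ### Plane waves with a cutoff -/

/-- A plane wave, cut off at distance of order `1 / c`. -/
def cutoffWave {n : ℕ} (χ : EuclideanSpace ℝ (Fin n) → ℝ) (ξ : EuclideanSpace ℝ (Fin n))
    (θ c : ℝ) (x : EuclideanSpace ℝ (Fin n)) : ℝ :=
  χ (c • x) * Real.cos (inner ℝ ξ x + θ)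

section Cutoff

variable {n : ℕ} {χ : EuclideanSpace ℝ (Fin n) → ℝ}

theorem contDiff_cutoffWave (hχ : ContDiff ℝ 2 χ) (ξ : EuclideanSpace ℝ (Fin n)) (θ c : ℝ) :
    ContDiff ℝ 2 (cutoffWave χ ξ θ c) := by
  unfold cutoffWave
  exact (hχ.comp (contDiff_const_smul c)).mul
    (Real.contDiff_cos.comp (((innerSL ℝ ξ).contDiff).add contDiff_const))

theorem hasCompactSupport_cutoffWave (hs : HasCompactSupport χ) (ξ : EuclideanSpace ℝ (Fin n))
    (θ : ℝ) {c : ℝ} (hc : c ≠ 0) : HasCompactSupport (cutoffWave χ ξ θ c) :=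
  HasCompactSupport.mul_right (hs.comp_smul hc)

theorem abs_cutoffWave_le (h1 : ∀ x, |χ x| ≤ 1) (ξ : EuclideanSpace ℝ (Fin n)) (θ c : ℝ)
    (x : EuclideanSpace ℝ (Fin n)) : |cutoffWave χ ξ θ c x| ≤ 1 := by
  rw [cutoffWave, abs_mul]
  exact mul_le_one₀ (h1 _) (abs_nonneg _) (Real.abs_cos_le_one _)

theorem hasFDerivAt_comp_smul {f : EuclideanSpace ℝ (Fin n) → ℝ} (c : ℝ)
    (x : EuclideanSpace ℝ (Fin n)) (hf : DifferentiableAt ℝ f (c • x)) :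
    HasFDerivAt (fun z => f (c • z)) (c • fderiv ℝ f (c • x)) x := by
  have h := hf.hasFDerivAt.comp x ((hasFDerivAt_id x).const_smul c)
  have e : (fderiv ℝ f (c • x)).comp (c • ContinuousLinearMap.id ℝ _)
      = c • fderiv ℝ f (c • x) := by
    ext v
    simp
  rw [← e]
  exact h

theorem hasFDerivAt_inner_add (ξ x : EuclideanSpace ℝ (Fin n)) (θ : ℝ) :
    HasFDerivAt (fun z => inner ℝ ξ z + θ) (innerSL ℝ ξ) x :=
  ((innerSL ℝ ξ).hasFDerivAt).add_const θ

theorem fderiv_cutoffWave_apply (hχ : ContDiff ℝ 2 χ) (ξ : EuclideanSpace ℝ (Fin n)) (θ c : ℝ)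
    (x e : EuclideanSpace ℝ (Fin n)) :
    fderiv ℝ (cutoffWave χ ξ θ c) x e
      = χ (c • x) * (-Real.sin (inner ℝ ξ x + θ) * inner ℝ ξ e)
        + fderiv ℝ χ (c • x) e * (c * Real.cos (inner ℝ ξ x + θ)) := by
  have h1 := hasFDerivAt_comp_smul c x (hχ.differentiable (by norm_num) (c • x))
  have h2 := (hasFDerivAt_inner_add ξ x θ).cos
  have h3 : HasFDerivAt (cutoffWave χ ξ θ c) _ x := h1.fun_mul h2
  rw [h3.fderiv]
  simp only [add_apply, smul_apply, smul_eq_mul, innerSL_apply_apply]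
  ring

theorem fderiv_fderiv_cutoffWave_apply (hχ : ContDiff ℝ 2 χ) (ξ : EuclideanSpace ℝ (Fin n))
    (θ c : ℝ) (x e : EuclideanSpace ℝ (Fin n)) :
    fderiv ℝ (fun z => fderiv ℝ (cutoffWave χ ξ θ c) z e) x e
      = -(inner ℝ ξ e) ^ 2 * cutoffWave χ ξ θ c x
        + c * (c * (fderiv ℝ (fun z => fderiv ℝ χ z e) (c • x) e * Real.cos (inner ℝ ξ x + θ))
          - 2 * inner ℝ ξ e * (fderiv ℝ χ (c • x) e * Real.sin (inner ℝ ξ x + θ))) := by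
  have hd : Differentiable ℝ fun z => fderiv ℝ χ z e :=
    ((hχ.fderiv_right (m := 1) (by norm_num)).clm_apply contDiff_const).differentiable
      (by norm_num)
  have h1 := hasFDerivAt_comp_smul c x (hχ.differentiable (by norm_num) (c • x))
  have h2 := hasFDerivAt_comp_smul c x (hd (c • x))
  have hcos := (hasFDerivAt_inner_add ξ x θ).cos
  have hsin := (hasFDerivAt_inner_add ξ x θ).sin
  have h3 : HasFDerivAt (fun z => fderiv ℝ (cutoffWave χ ξ θ c) z e) _ x :=
    ((h1.fun_mul (hsin.fun_neg.mul_const (inner ℝ ξ e))).fun_add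
      (h2.fun_mul (hcos.const_mul c))).congr_of_eventuallyEq
      (Eventually.of_forall fun z => fderiv_cutoffWave_apply hχ ξ θ c z e)
  rw [h3.fderiv]
  simp only [add_apply, smul_apply, smul_eq_mul, innerSL_apply_apply, neg_apply, cutoffWave]
  ring

/-- Both derivatives falling on the wave give exactly `-‖ξ‖ ^ 2` times the function, and each
derivative falling on the cutoff costs a factor `c`. The constant is independent of `c` because `c ≤
1` absorbs the quadratic term. -/
theorem exists_abs_laplacian_cutoffWave_le (hχ : ContDiff ℝ 2 χ) (hs : HasCompactSupport χ)
    (ξ : EuclideanSpace ℝ (Fin n)) (θ : ℝ) :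
    ∃ K : ℝ, 0 ≤ K ∧ ∀ c : ℝ, 0 < c → c ≤ 1 → ∀ x,
      |Laplacian.laplacian (cutoffWave χ ξ θ c) x + ‖ξ‖ ^ 2 * cutoffWave χ ξ θ c x| ≤ c * K := by
  set e := EuclideanSpace.basisFun (Fin n) ℝ with he
  have h1 : ∀ i, ContDiff ℝ 1 fun z => fderiv ℝ χ z (e i) := fun i =>
    (hχ.fderiv_right (m := 1) (by norm_num)).clm_apply contDiff_const
  have h2 : ∀ i, Continuous fun z => fderiv ℝ (fun z => fderiv ℝ χ z (e i)) z (e i) := fun i =>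
    ((h1 i).continuous_fderiv (by norm_num)).clm_apply continuous_const
  have hA : ∀ i, ∃ A, ∀ z, ‖fderiv ℝ χ z (e i)‖ ≤ A := fun i =>
    (hs.fderiv_apply ℝ (e i)).exists_bound_of_continuous (h1 i).continuous
  have hB : ∀ i, ∃ A, ∀ z, ‖fderiv ℝ (fun z => fderiv ℝ χ z (e i)) z (e i)‖ ≤ A := fun i =>
    ((hs.fderiv_apply ℝ (e i)).fderiv_apply ℝ (e i)).exists_bound_of_continuous (h2 i)
  choose A hA using hA
  choose B hB using hB
  have hA0 : ∀ i, 0 ≤ A i := fun i => (norm_nonneg _).trans (hA i 0)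
  have hB0 : ∀ i, 0 ≤ B i := fun i => (norm_nonneg _).trans (hB i 0)
  refine ⟨∑ i, (B i + 2 * |inner ℝ ξ (e i)| * A i),
    Finset.sum_nonneg fun i _ => by have := hA0 i; have := hB0 i; positivity,
    fun c hc hc1 x => ?_⟩
  rw [laplacian_eq_sum_fderiv (contDiff_cutoffWave hχ ξ θ c).contDiffAt]
  simp_rw [fderiv_fderiv_cutoffWave_apply hχ]
  have hn : ‖ξ‖ ^ 2 = ∑ i, (inner ℝ ξ (e i)) ^ 2 := by
    have := e.sum_sq_norm_inner_left ξ
    simp only [Real.norm_eq_abs, sq_abs] at this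
    exact this.symm
  rw [hn, Finset.sum_add_distrib, ← Finset.sum_mul, ← Finset.mul_sum, Finset.sum_neg_distrib,
    neg_mul, neg_add_cancel_comm, abs_mul, abs_of_pos hc]
  refine mul_le_mul_of_nonneg_left ((Finset.abs_sum_le_sum_abs _ _).trans
    (Finset.sum_le_sum fun i _ => ?_)) hc.le
  refine (abs_sub _ _).trans (add_le_add ?_ ?_)
  · rw [abs_mul, abs_mul, abs_of_pos hc]
    have h3 : |fderiv ℝ (fun z => fderiv ℝ χ z (e i)) (c • x) (e i)| *
        |Real.cos (inner ℝ ξ x + θ)| ≤ B i * 1 :=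
      mul_le_mul (hB i _) (Real.abs_cos_le_one _) (abs_nonneg _) (hB0 i)
    calc _ ≤ 1 * (B i * 1) := mul_le_mul hc1 h3 (by positivity) zero_le_one
      _ = B i := by ring
  · rw [abs_mul, abs_mul, abs_mul, abs_of_pos (two_pos : (0 : ℝ) < 2)]
    have h3 : |fderiv ℝ χ (c • x) (e i)| * |Real.sin (inner ℝ ξ x + θ)| ≤ A i * 1 :=
      mul_le_mul (hA i _) (Real.abs_sin_le_one _) (abs_nonneg _) (hA0 i)
    rw [mul_one] at h3
    exact mul_le_mul_of_nonneg_left h3 (by positivity)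

end Cutoff

/-! ### Testing against compactly supported functions, and Fourier inversion -/

/-- Green's identity on the whole space, for a test function of compact support. -/
theorem integral_laplacian_mul_eq {n : ℕ} {f ψ : EuclideanSpace ℝ (Fin n) → ℝ}
    (hf : ContDiff ℝ 2 f) (hψ : ContDiff ℝ 2 ψ) (hs : HasCompactSupport ψ) :
    ∫ x, Laplacian.laplacian f x * ψ x = ∫ x, f x * Laplacian.laplacian ψ x := by
  set e := EuclideanSpace.basisFun (Fin n) ℝ with he
  have hD : ∀ {g : EuclideanSpace ℝ (Fin n) → ℝ}, ContDiff ℝ 2 g → ∀ i,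
      ContDiff ℝ 1 fun z => fderiv ℝ g z (e i) := fun hg i =>
    (hg.fderiv_right (m := 1) (by norm_num)).clm_apply contDiff_const
  have hDD : ∀ {g : EuclideanSpace ℝ (Fin n) → ℝ}, ContDiff ℝ 2 g → ∀ i,
      Continuous fun z => fderiv ℝ (fun z => fderiv ℝ g z (e i)) z (e i) := fun hg i =>
    ((hD hg i).continuous_fderiv (by norm_num)).clm_apply continuous_const
  have hs1 : ∀ i, HasCompactSupport fun z => fderiv ℝ ψ z (e i) := fun i =>
    hs.fderiv_apply ℝ (e i)
  have hs2 : ∀ i, HasCompactSupport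
      fun z => fderiv ℝ (fun z => fderiv ℝ ψ z (e i)) z (e i) := fun i =>
    (hs1 i).fderiv_apply ℝ (e i)
  have i1 : ∀ i, Integrable fun x => fderiv ℝ (fun z => fderiv ℝ f z (e i)) x (e i) * ψ x :=
    fun i => ((hDD hf i).mul hψ.continuous).integrable_of_hasCompactSupport hs.mul_left
  have i2 : ∀ i, Integrable fun x => f x * fderiv ℝ (fun z => fderiv ℝ ψ z (e i)) x (e i) :=
    fun i => (hf.continuous.mul (hDD hψ i)).integrable_of_hasCompactSupport (hs2 i).mul_left
  have i3 : ∀ i, Integrable fun x => fderiv ℝ f x (e i) * fderiv ℝ ψ x (e i) := fun i =>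
    ((hD hf i).continuous.mul (hD hψ i).continuous).integrable_of_hasCompactSupport
      (hs1 i).mul_left
  have i4 : ∀ i, Integrable fun x => f x * fderiv ℝ ψ x (e i) := fun i =>
    (hf.continuous.mul (hD hψ i).continuous).integrable_of_hasCompactSupport (hs1 i).mul_left
  have i5 : ∀ i, Integrable fun x => fderiv ℝ f x (e i) * ψ x := fun i =>
    ((hD hf i).continuous.mul hψ.continuous).integrable_of_hasCompactSupport hs.mul_left
  simp_rw [fun x => laplacian_eq_sum_fderiv (x := x) hf.contDiffAt,
    fun x => laplacian_eq_sum_fderiv (x := x) hψ.contDiffAt, Finset.sum_mul, Finset.mul_sum]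
  rw [integral_finsetSum _ fun i _ => i1 i, integral_finsetSum _ fun i _ => i2 i]
  refine Finset.sum_congr rfl fun i _ => ?_
  rw [integral_mul_fderiv_eq_neg_fderiv_mul_of_integrable (i3 i) (i2 i) (i4 i)
      (fun x _ => hf.differentiable (by norm_num) x)
      (fun x _ => (hD hψ i).differentiable (by norm_num) x),
    integral_mul_fderiv_eq_neg_fderiv_mul_of_integrable (i1 i) (i3 i) (i5 i)
      (fun x _ => (hD hf i).differentiable (by norm_num) x)
      (fun x _ => hψ.differentiable (by norm_num) x), neg_neg]

/-- Differentiation in time of the integral against a test function of compact support. -/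
theorem hasDerivAt_integral_mul_of_hasCompactSupport {n : ℕ}
    {v v' : EuclideanSpace ℝ (Fin n) → ℝ → ℝ}
    (hv : ContDiffOn ℝ 2 (fun q : EuclideanSpace ℝ (Fin n) × ℝ => v q.1 q.2)
      (Set.univ ×ˢ Set.Ioi 0))
    (hv' : ∀ x t, 0 < t → HasDerivAt (fun s => v x s) (v' x t) t)
    {ψ : EuclideanSpace ℝ (Fin n) → ℝ} (hψ : Continuous ψ) (hs : HasCompactSupport ψ)
    {t : ℝ} (ht : 0 < t) :
    HasDerivAt (fun s => ∫ x, v x s * ψ x) (∫ x, v' x t * ψ x) t := by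
  set S : Set (EuclideanSpace ℝ (Fin n) × ℝ) := Set.univ ×ˢ Set.Ioi 0 with hS
  set F : EuclideanSpace ℝ (Fin n) × ℝ → ℝ := fun q => v q.1 q.2 with hF
  have hSo : IsOpen S := isOpen_univ.prod isOpen_Ioi
  -- Joint smoothness identifies `v'` with a component of the total derivative; hence `v'` is
  -- jointly continuous and bounded on compact sets, which provides the domination.
  have hd : ∀ x s, 0 < s → v' x s = fderiv ℝ F (x, s) (0, 1) := fun x s hs => by
    have hmem : (x, s) ∈ S := ⟨trivial, hs⟩
    have h1 : HasFDerivAt F (fderiv ℝ F (x, s)) (x, s) :=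
      ((hv.contDiffAt (hSo.mem_nhds hmem)).differentiableAt (by norm_num)).hasFDerivAt
    have h2 : HasDerivAt (fun s : ℝ => (x, s)) ((0 : EuclideanSpace ℝ (Fin n)), (1 : ℝ)) s :=
      (hasDerivAt_const s x).prodMk (hasDerivAt_id s)
    exact (hv' x s hs).unique (h1.comp_hasDerivAt s h2)
  have hcont : ContinuousOn (fun q : EuclideanSpace ℝ (Fin n) × ℝ => v' q.1 q.2) S := by
    have h1 : ContinuousOn (fun q => fderiv ℝ F q (0, 1)) S :=
      (hv.continuousOn_fderiv_of_isOpen hSo (by norm_num)).clm_apply continuousOn_const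
    exact h1.congr fun q hq => hd q.1 q.2 hq.2
  have hslice : ∀ s, 0 < s → Continuous fun x => v x s := fun s hs => by
    have := hv.continuousOn.comp_continuous (f := fun x : EuclideanSpace ℝ (Fin n) => (x, s))
      (by fun_prop) (fun x => ⟨trivial, hs⟩)
    exact this
  have hslice' : Continuous fun x => v' x t :=
    hcont.comp_continuous (f := fun x : EuclideanSpace ℝ (Fin n) => (x, t))
      (by fun_prop) (fun x => ⟨trivial, ht⟩)
  -- A time window around `t` that stays away from `0`, where no regularity is assumed.
  have hK : IsCompact (tsupport ψ ×ˢ Set.Icc (t / 2) (2 * t)) :=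
    IsCompact.prod hs isCompact_Icc
  obtain ⟨C, hC⟩ := hK.exists_bound_of_continuousOn
    (hcont.mono fun q hq => ⟨trivial, lt_of_lt_of_le (by positivity) hq.2.1⟩)
  refine (hasDerivAt_integral_of_dominated_loc_of_deriv_le
    (F := fun s x => v x s * ψ x) (F' := fun s x => v' x s * ψ x)
    (s := Set.Icc (t / 2) (2 * t)) (bound := fun x => C * |ψ x|)
    (Icc_mem_nhds (by linarith) (by linarith)) ?_ ?_ ?_ ?_ ?_ ?_).2
  · filter_upwards [Ioi_mem_nhds ht] with s hs'
    exact ((hslice s hs').mul hψ).aestronglyMeasurable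
  · exact ((hslice t ht).mul hψ).integrable_of_hasCompactSupport hs.mul_left
  · exact (hslice'.mul hψ).aestronglyMeasurable
  · refine Eventually.of_forall fun x s hs' => ?_
    by_cases hx : x ∈ tsupport ψ
    · rw [norm_mul, Real.norm_eq_abs (ψ x)]
      exact mul_le_mul_of_nonneg_right (hC (x, s) ⟨hx, hs'⟩) (abs_nonneg _)
    · simp [image_eq_zero_of_notMem_tsupport hx]
  · exact (hψ.abs.integrable_of_hasCompactSupport hs.abs).const_mul C
  · exact Eventually.of_forall fun x s hs' =>
      (hv' x s (lt_of_lt_of_le (by positivity) hs'.1)).mul_const _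

/-- A continuous integrable function that is orthogonal to all plane waves vanishes. -/
theorem eq_zero_of_integral_mul_cos_eq_zero {n : ℕ} {f : EuclideanSpace ℝ (Fin n) → ℝ}
    (hc : Continuous f) (hi : Integrable f)
    (h : ∀ (ξ : EuclideanSpace ℝ (Fin n)) (θ : ℝ),
      ∫ x, f x * Real.cos (inner ℝ ξ x + θ) = 0) (x : EuclideanSpace ℝ (Fin n)) : f x = 0 := by
  set g : EuclideanSpace ℝ (Fin n) → ℂ := fun x => (f x : ℂ) with hg
  have hgi : Integrable g := hi.ofReal
  have hF : FourierTransform.fourier g = 0 := by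
    funext w
    rw [Real.fourier_eq', Pi.zero_apply]
    have hint : Integrable fun v =>
        Complex.exp (((-2 * Real.pi * inner ℝ v w : ℝ) : ℂ) * Complex.I) • g v := by
      simp only [smul_eq_mul]
      refine hgi.bdd_mul (c := 1) ?_ (Eventually.of_forall fun v => ?_)
      · exact (by fun_prop : Continuous fun v : EuclideanSpace ℝ (Fin n) =>
          Complex.exp (((-2 * Real.pi * inner ℝ v w : ℝ) : ℂ) * Complex.I)).aestronglyMeasurable
      · rw [Complex.norm_exp_ofReal_mul_I]
    have hre := integral_re hint
    have him := integral_im hint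
    -- The factor `-2π` is the Fourier convention; the phases `0` and `-π / 2` then yield the real
    -- and imaginary parts.
    have e : ∀ v : EuclideanSpace ℝ (Fin n),
        inner ℝ ((-2 * Real.pi) • w) v = -2 * Real.pi * inner ℝ v w := fun v => by
      rw [real_inner_smul_left, real_inner_comm]
    apply Complex.ext
    · refine hre.symm.trans (Eq.trans (integral_congr_ae (Eventually.of_forall fun v => ?_))
        (h ((-2 * Real.pi) • w) 0))
      simp only [hg, smul_eq_mul, RCLike.re_to_complex, Complex.re_mul_ofReal,
        Complex.exp_ofReal_mul_I_re, e, add_zero]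
      ring
    · refine him.symm.trans (Eq.trans (integral_congr_ae (Eventually.of_forall fun v => ?_))
        (h ((-2 * Real.pi) • w) (-(Real.pi / 2))))
      simp only [hg, smul_eq_mul, RCLike.im_to_complex, Complex.im_mul_ofReal,
        Complex.exp_ofReal_mul_I_im, e, ← sub_eq_add_neg, Real.cos_sub_pi_div_two]
      ring
  -- Inversion needs an integrable transform, which is immediate as the transform is zero.
  have hinv := Continuous.fourierInv_fourier_eq (f := g) (Complex.continuous_ofReal.comp hc) hgi
    (by rw [hF]; exact integrable_zero _ _ _)
  rw [hF] at hinv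
  have hx := congrFun hinv x
  rw [Real.fourierInv_eq'] at hx
  simp only [Pi.zero_apply, smul_zero, integral_zero] at hx
  exact Complex.ofReal_eq_zero.1 hx.symm

theorem continuous_laplacian {n : ℕ} {f : EuclideanSpace ℝ (Fin n) → ℝ} (hf : ContDiff ℝ 2 f) :
    Continuous (Laplacian.laplacian f) := by
  have : Laplacian.laplacian f = fun x => ∑ i, fderiv ℝ
      (fun z => fderiv ℝ f z (EuclideanSpace.basisFun (Fin n) ℝ i)) x
        (EuclideanSpace.basisFun (Fin n) ℝ i) :=
    funext fun x => laplacian_eq_sum_fderiv hf.contDiffAt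
  rw [this]
  refine continuous_finsetSum _ fun i _ => ?_
  have h1 : ContDiff ℝ 1 fun z => fderiv ℝ f z (EuclideanSpace.basisFun (Fin n) ℝ i) :=
    (hf.fderiv_right (m := 1) (by norm_num)).clm_apply contDiff_const
  exact (h1.continuous_fderiv (by norm_num)).clm_apply continuous_const

theorem contDiff_slice {n : ℕ} {v : EuclideanSpace ℝ (Fin n) → ℝ → ℝ}
    (hv : ContDiffOn ℝ 2 (fun q : EuclideanSpace ℝ (Fin n) × ℝ => v q.1 q.2)
      (Set.univ ×ˢ Set.Ioi 0)) {t : ℝ} (ht : 0 < t) : ContDiff ℝ 2 fun x => v x t := by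
  have h : ContDiff ℝ 2 fun x : EuclideanSpace ℝ (Fin n) => (x, t) :=
    contDiff_id.prodMk contDiff_const
  exact contDiffOn_univ.1 (hv.comp h.contDiffOn fun x _ => ⟨trivial, ht⟩)

/-! ### Uniqueness for the killed heat equation and for the system -/

/-- An `L¹`-bounded solution of the heat equation with killing: its tested masses, rescaled to
remove the decay of the plane wave, change slowly. -/
theorem abs_exp_mul_integral_cutoffWave_sub_le {n : ℕ} {D lam : ℝ} (hD : 0 < D) (hlam : 0 < lam)
    {v : EuclideanSpace ℝ (Fin n) → ℝ → ℝ}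
    (hv : ContDiffOn ℝ 2 (fun q : EuclideanSpace ℝ (Fin n) × ℝ => v q.1 q.2)
      (Set.univ ×ˢ Set.Ioi 0))
    (hpde : ∀ x t, 0 < t → HasDerivAt (fun s => v x s)
      (D * Laplacian.laplacian (fun x' => v x' t) x - lam * v x t) t)
    (hint : ∀ t, 0 < t → Integrable fun x => v x t)
    {T C : ℝ} (hC : ∀ t, 0 < t → t ≤ T → ∫ x, |v x t| ≤ C)
    {χ : EuclideanSpace ℝ (Fin n) → ℝ} (hχ : ContDiff ℝ 2 χ) (hs : HasCompactSupport χ)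
    (ξ : EuclideanSpace ℝ (Fin n)) (θ : ℝ) {c K : ℝ} (hc : 0 < c) (hK0 : 0 ≤ K)
    (hK : ∀ x, |Laplacian.laplacian (cutoffWave χ ξ θ c) x
      + ‖ξ‖ ^ 2 * cutoffWave χ ξ θ c x| ≤ c * K) {s t : ℝ} (hs0 : 0 < s) (hst : s ≤ t)
    (htT : t ≤ T) :
    |Real.exp ((lam + D * ‖ξ‖ ^ 2) * t) * (∫ x, v x t * cutoffWave χ ξ θ c x)
      - Real.exp ((lam + D * ‖ξ‖ ^ 2) * s) * ∫ x, v x s * cutoffWave χ ξ θ c x|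
      ≤ Real.exp ((lam + D * ‖ξ‖ ^ 2) * T) * (D * (C * (c * K))) * (t - s) := by
  set μ := lam + D * ‖ξ‖ ^ 2 with hμ
  have hμ0 : 0 < μ := by positivity
  set ψ := cutoffWave χ ξ θ c with hψ
  have hψ2 : ContDiff ℝ 2 ψ := contDiff_cutoffWave hχ ξ θ c
  have hψs : HasCompactSupport ψ := hasCompactSupport_cutoffWave hs ξ θ hc.ne'
  -- The factor `exp (μ r)` cancels both the killing and the eigenvalue of the wave; only the error
  -- made by the cutoff survives in the derivative.
  have key : ∀ r, 0 < r → HasDerivAt (fun r => Real.exp (μ * r) * ∫ x, v x r * ψ x)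
      (Real.exp (μ * r) * (D * ∫ x, v x r * (Laplacian.laplacian ψ x + ‖ξ‖ ^ 2 * ψ x))) r := by
    intro r hr
    have hvr : ContDiff ℝ 2 fun x => v x r := contDiff_slice hv hr
    have h1 : HasDerivAt (fun r => Real.exp (μ * r)) (Real.exp (μ * r) * (μ * 1)) r :=
      ((hasDerivAt_id r).const_mul μ).exp
    have h2 := hasDerivAt_integral_mul_of_hasCompactSupport hv hpde hψ2.continuous hψs hr
    have i1 : Integrable fun x => Laplacian.laplacian (fun x' => v x' r) x * ψ x :=
      ((continuous_laplacian hvr).mul hψ2.continuous).integrable_of_hasCompactSupport hψs.mul_left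
    have i2 : Integrable fun x => v x r * ψ x :=
      (hvr.continuous.mul hψ2.continuous).integrable_of_hasCompactSupport hψs.mul_left
    have hLs : HasCompactSupport (Laplacian.laplacian ψ) := by
      refine HasCompactSupport.intro hψs fun x hx => ?_
      have : ψ =ᶠ[𝓝 x] fun _ => 0 := notMem_tsupport_iff_eventuallyEq.1 hx
      rw [(InnerProductSpace.laplacian_congr_nhds this).eq_of_nhds]
      exact congrFun (InnerProductSpace.laplacian_const (E := EuclideanSpace ℝ (Fin n))) x
    have i3 : Integrable fun x => v x r * Laplacian.laplacian ψ x :=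
      (hvr.continuous.mul (continuous_laplacian hψ2)).integrable_of_hasCompactSupport hLs.mul_left
    refine (h1.fun_mul h2).congr_deriv ?_
    have e1 : ∫ x, (D * Laplacian.laplacian (fun x' => v x' r) x - lam * v x r) * ψ x
        = D * (∫ x, v x r * Laplacian.laplacian ψ x) - lam * ∫ x, v x r * ψ x := by
      rw [← integral_laplacian_mul_eq hvr hψ2 hψs, ← integral_const_mul, ← integral_const_mul,
        ← integral_sub (i1.const_mul D) (i2.const_mul lam)]
      exact integral_congr_ae (Eventually.of_forall fun x => by ring)
    have e2 : ∫ x, v x r * (Laplacian.laplacian ψ x + ‖ξ‖ ^ 2 * ψ x)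
        = (∫ x, v x r * Laplacian.laplacian ψ x) + ‖ξ‖ ^ 2 * ∫ x, v x r * ψ x := by
      rw [← integral_const_mul, ← integral_add i3 (i2.const_mul _)]
      exact integral_congr_ae (Eventually.of_forall fun x => by ring)
    rw [e1, e2, hμ]
    ring
  have hbound : ∀ r ∈ Set.Icc s t, ‖Real.exp (μ * r) *
      (D * ∫ x, v x r * (Laplacian.laplacian ψ x + ‖ξ‖ ^ 2 * ψ x))‖
      ≤ Real.exp (μ * T) * (D * (C * (c * K))) := by
    intro r hr
    have hr0 : 0 < r := lt_of_lt_of_le hs0 hr.1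
    have hrT : r ≤ T := hr.2.trans htT
    have h1 : ‖∫ x, v x r * (Laplacian.laplacian ψ x + ‖ξ‖ ^ 2 * ψ x)‖
        ≤ ∫ x, |v x r| * (c * K) := by
      refine norm_integral_le_of_norm_le ((hint r hr0).abs.mul_const _)
        (Eventually.of_forall fun x => ?_)
      rw [norm_mul]
      exact mul_le_mul_of_nonneg_left (hK x) (abs_nonneg _)
    rw [integral_mul_const] at h1
    have h2 : (∫ x, |v x r|) * (c * K) ≤ C * (c * K) :=
      mul_le_mul_of_nonneg_right (hC r hr0 hrT) (by positivity)
    rw [norm_mul, norm_mul, Real.norm_eq_abs, Real.abs_exp, Real.norm_eq_abs D, abs_of_pos hD]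
    exact mul_le_mul (Real.exp_le_exp.2 (by gcongr))
      (mul_le_mul_of_nonneg_left (h1.trans h2) hD.le) (by positivity) (Real.exp_pos _).le
  have := (convex_Icc s t).norm_image_sub_le_of_norm_hasDerivWithin_le
    (fun r hr => (key r (lt_of_lt_of_le hs0 hr.1)).hasDerivWithinAt) hbound
    (Set.left_mem_Icc.2 hst) (Set.right_mem_Icc.2 hst)
  rwa [Real.norm_eq_abs, Real.norm_eq_abs, abs_of_nonneg (sub_nonneg.2 hst)] at this

/-- Uniqueness for the heat equation with killing among solutions bounded in `L¹`. -/
theorem eq_zero_of_heat_equation {n : ℕ} {D lam : ℝ} (hD : 0 < D) (hlam : 0 < lam)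
    {v : EuclideanSpace ℝ (Fin n) → ℝ → ℝ}
    (hv : ContDiffOn ℝ 2 (fun q : EuclideanSpace ℝ (Fin n) × ℝ => v q.1 q.2)
      (Set.univ ×ˢ Set.Ioi 0))
    (hpde : ∀ x t, 0 < t → HasDerivAt (fun s => v x s)
      (D * Laplacian.laplacian (fun x' => v x' t) x - lam * v x t) t)
    (hint : ∀ t, 0 < t → Integrable fun x => v x t)
    (hbdd : ∀ T : ℝ, 0 < T → ∃ C : ℝ, ∀ t, 0 < t → t ≤ T → ∫ x, |v x t| ≤ C)
    (hlim : ∀ f : EuclideanSpace ℝ (Fin n) →ᵇ ℝ,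
      Tendsto (fun t => ∫ x, f x * v x t) (𝓝[>] 0) (𝓝 0))
    (x : EuclideanSpace ℝ (Fin n)) {t : ℝ} (ht : 0 < t) : v x t = 0 := by
  refine eq_zero_of_integral_mul_cos_eq_zero (f := fun x => v x t)
    (contDiff_slice hv ht).continuous (hint t ht) (fun ξ θ => ?_) x
  obtain ⟨C, hC⟩ := hbdd t ht
  -- The radii are immaterial: what matters is a smooth compactly supported cutoff with values in
  -- `[0, 1]` and equal to `1` at the origin.
  let b : ContDiffBump (0 : EuclideanSpace ℝ (Fin n)) := ⟨1, 2, one_pos, one_lt_two⟩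
  set χ : EuclideanSpace ℝ (Fin n) → ℝ := ⇑b with hχ
  have hχ2 : ContDiff ℝ 2 χ := b.contDiff
  have hχs : HasCompactSupport χ := b.hasCompactSupport
  have hχ1 : ∀ x, |χ x| ≤ 1 := fun x => by
    rw [hχ, abs_of_nonneg b.nonneg]
    exact b.le_one
  have hχ0 : χ 0 = 1 := b.one_of_mem_closedBall (by simp [b])
  obtain ⟨K, hK0, hK⟩ := exists_abs_laplacian_cutoffWave_le hχ2 hχs ξ θ
  set μ := lam + D * ‖ξ‖ ^ 2 with hμ
  set J : ℝ → ℝ := fun s => ∫ x, v x s * Real.cos (inner ℝ ξ x + θ) with hJ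
  have hI : ∀ s, 0 < s → Tendsto (fun c => ∫ x, v x s * cutoffWave χ ξ θ c x) (𝓝[>] 0)
      (𝓝 (J s)) := fun s hs => by
    refine tendsto_integral_filter_of_dominated_convergence (fun x => |v x s|)
      (Eventually.of_forall fun c => ?_)
      (Eventually.of_forall fun c => Eventually.of_forall fun x => ?_)
      (hint s hs).abs (Eventually.of_forall fun x => ?_)
    · exact ((contDiff_slice hv hs).continuous.mul
        (contDiff_cutoffWave hχ2 ξ θ c).continuous).aestronglyMeasurable
    · rw [norm_mul]
      exact mul_le_of_le_one_right (abs_nonneg _) (abs_cutoffWave_le hχ1 ξ θ c x)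
    · have h1 : Continuous fun c : ℝ => v x s * cutoffWave χ ξ θ c x := by
        have := hχ2.continuous
        unfold cutoffWave
        fun_prop
      have h2 := h1.tendsto 0
      simp only [cutoffWave, zero_smul, hχ0, one_mul] at h2
      exact h2.mono_left nhdsWithin_le_nhds
  -- As `c` tends to `0` the tested integrals converge to those against the full wave, while the
  -- bound on their variation, linear in `c`, disappears.
  have hconst : ∀ s, 0 < s → s ≤ t → Real.exp (μ * t) * J t = Real.exp (μ * s) * J s := by
    intro s hs hst
    have h1 : Tendsto (fun c : ℝ => |Real.exp (μ * t) * (∫ x, v x t * cutoffWave χ ξ θ c x)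
        - Real.exp (μ * s) * ∫ x, v x s * cutoffWave χ ξ θ c x|) (𝓝[>] 0)
        (𝓝 |Real.exp (μ * t) * J t - Real.exp (μ * s) * J s|) :=
      (((hI t ht).const_mul _).sub ((hI s hs).const_mul _)).abs
    have h2 : Tendsto (fun c : ℝ => Real.exp (μ * t) * (D * (C * (c * K))) * (t - s)) (𝓝[>] 0)
        (𝓝 (Real.exp (μ * t) * (D * (C * (0 * K))) * (t - s))) :=
      ((by fun_prop : Continuous fun c : ℝ =>
        Real.exp (μ * t) * (D * (C * (c * K))) * (t - s)).tendsto 0).mono_left nhdsWithin_le_nhds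
    have h3 := le_of_tendsto_of_tendsto h1 h2 (by
      filter_upwards [self_mem_nhdsWithin, mem_nhdsWithin_of_mem_nhds (Iic_mem_nhds one_pos)]
        with c hc hc1
      exact abs_exp_mul_integral_cutoffWave_sub_le hD hlam hv hpde hint hC hχ2 hχs ξ θ hc hK0
        (hK c hc hc1) hs hst le_rfl)
    simp only [zero_mul, mul_zero] at h3
    exact sub_eq_zero.1 (abs_eq_zero.1 (le_antisymm h3 (abs_nonneg _)))
  have hJ0 : Tendsto (fun s => Real.exp (μ * s) * J s) (𝓝[>] 0) (𝓝 (Real.exp (μ * 0) * 0)) := by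
    refine Tendsto.mul (((by fun_prop : Continuous fun s : ℝ => Real.exp (μ * s)).tendsto
      0).mono_left nhdsWithin_le_nhds) ?_
    -- The full wave is bounded and continuous, so the weak initial condition applies to it without
    -- a cutoff.
    have := hlim (BoundedContinuousFunction.ofNormedAddCommGroup
      (fun x => Real.cos (inner ℝ ξ x + θ)) (by fun_prop) 1
      (fun x => Real.abs_cos_le_one _))
    refine this.congr fun s => integral_congr_ae (Eventually.of_forall fun x => ?_)
    exact mul_comm _ _
  have hJt : Tendsto (fun s => Real.exp (μ * s) * J s) (𝓝[>] 0)
      (𝓝 (Real.exp (μ * t) * J t)) := by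
    refine tendsto_const_nhds.congr' ?_
    filter_upwards [Ioc_mem_nhdsGT ht] with s hs using hconst s hs.1 hs.2
  have := tendsto_nhds_unique hJt hJ0
  rw [mul_zero] at this
  exact (mul_eq_zero.1 this).resolve_left (Real.exp_pos _).ne'

/-- The source terms coincide by induction, so the difference solves a homogeneous equation with
zero initial limit; the zeroth function is prescribed. -/
theorem SolvesMomentSystem.eq_of_pos {n : ℕ} {D lam B : ℝ} (hD : 0 < D) (hlam : 0 < lam)
    {y : EuclideanSpace ℝ (Fin n)} {a a' : ℕ → EuclideanSpace ℝ (Fin n) → ℝ → ℝ}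
    (ha : SolvesMomentSystem D lam B y a) (ha' : SolvesMomentSystem D lam B y a') (k : ℕ) :
    ∀ (x : EuclideanSpace ℝ (Fin n)) (t : ℝ), 0 < t → a k x t = a' k x t := by
  induction k with
  | zero => exact fun x t ht => (ha.zeroth x t ht).trans (ha'.zeroth x t ht).symm
  | succ k ih =>
    have hk : 1 ≤ k + 1 := Nat.le_add_left 1 k
    intro x t ht
    refine sub_eq_zero.1 (eq_zero_of_heat_equation (v := fun x t => a (k + 1) x t - a' (k + 1) x t)
      hD hlam ((ha.smooth _ hk).sub (ha'.smooth _ hk)) (fun x t ht => ?_)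
      (fun t ht => (ha.integrable _ hk t ht).sub (ha'.integrable _ hk t ht)) (fun T hT => ?_)
      (fun f => ?_) x ht)
    · refine ((ha.pde _ hk x t ht).fun_sub (ha'.pde _ hk x t ht)).congr_deriv ?_
      have := (contDiff_slice (ha.smooth _ hk) ht).contDiffAt.laplacian_sub (x := x)
        (contDiff_slice (ha'.smooth _ hk) ht).contDiffAt
      rw [show (fun x' => a (k + 1) x' t - a' (k + 1) x' t)
        = (fun x' => a (k + 1) x' t) - fun x' => a' (k + 1) x' t from rfl, this,
        Nat.add_sub_cancel, ih x t ht]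
      ring
    · obtain ⟨C, hC⟩ := ha.bounded _ hk T hT
      obtain ⟨C', hC'⟩ := ha'.bounded _ hk T hT
      refine ⟨C + C', fun t ht htT => ?_⟩
      have h1 := (ha.integrable _ hk t ht).abs
      have h2 := (ha'.integrable _ hk t ht).abs
      calc ∫ x, |a (k + 1) x t - a' (k + 1) x t|
          ≤ ∫ x, (|a (k + 1) x t| + |a' (k + 1) x t|) :=
            integral_mono ((ha.integrable _ hk t ht).sub (ha'.integrable _ hk t ht)).abs
              (h1.add h2) fun x => abs_sub _ _
        _ = (∫ x, |a (k + 1) x t|) + ∫ x, |a' (k + 1) x t| := integral_add h1 h2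
        _ ≤ C + C' := add_le_add (hC t ht htT) (hC' t ht htT)
    · have h := (ha.initial_limit _ hk f).sub (ha'.initial_limit _ hk f)
      rw [sub_zero] at h
      refine h.congr' ?_
      filter_upwards [self_mem_nhdsWithin] with t ht
      have hb : ∀ {g : EuclideanSpace ℝ (Fin n) → ℝ}, Integrable g →
          Integrable fun x => f x * g x := fun hg =>
        hg.bdd_mul f.continuous.aestronglyMeasurable
          (Eventually.of_forall fun x => f.norm_coe_le_norm x)
      rw [← integral_sub (hb (ha.integrable _ hk t ht)) (hb (ha'.integrable _ hk t ht))]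
      exact integral_congr_ae (Eventually.of_forall fun x => (mul_sub _ _ _).symm)

/-! ### Essential uniqueness of the densities, and the theorem -/

namespace BranchingDiffusion

theorem IsFirstMomentDensity.ae_eq {n : ℕ} {D lam : ℝ} {p : PMF ℕ} {Ω : Type*}
    [MeasurableSpace Ω] {P : Measure Ω} {X : BranchingDiffusion n D lam p P}
    {A A' : ℕ → EuclideanSpace ℝ (Fin n) → EuclideanSpace ℝ (Fin n) → ℝ → ℝ}
    (hA' : X.IsFirstMomentDensity A') (hA : X.IsFirstMomentDensity A) (k : ℕ)
    (y : EuclideanSpace ℝ (Fin n)) (t : ℝ) (ht : 0 ≤ t) (hkt : 0 < t ∨ 1 ≤ k) :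
    (fun x => A' k x y t) =ᵐ[volume] fun x => A k x y t := by
  obtain ⟨hm, h0, hG⟩ := hA k y t ht hkt
  obtain ⟨hm', h0', hG'⟩ := hA' k y t ht hkt
  have := ae_eq_of_forall_setLIntegral_eq_of_sigmaFinite hm'.ennreal_ofReal hm.ennreal_ofReal
    fun s hs _ => (hG' s hs).symm.trans (hG s hs)
  filter_upwards [this] with x hx
  exact (ENNReal.ofReal_eq_ofReal_iff (h0' x) (h0 x)).1 hx

end BranchingDiffusion

end

theorem corollary1 (n : ℕ) (D lam : ℝ) (hD : 0 < D) (hlam : 0 < lam)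
    (p : PMF ℕ) (B : ℝ) (hB : HasSum (fun i : ℕ => (i : ℝ) * (p i).toReal) B)
    {Ω : Type*} [MeasurableSpace Ω] (P : Measure Ω) [IsProbabilityMeasure P]
    (X : BranchingDiffusion n D lam p P) :
    -- the expected numbers are finite, are derivatives at `s = 0` of the moment generating
    -- functions, and at `t = 0` consist of a unit mass at `y` for `k = 0`
    (∀ (k : ℕ) (G : Set (EuclideanSpace ℝ (Fin n))), MeasurableSet G →
      ∀ (y : EuclideanSpace ℝ (Fin n)) (t : ℝ), 0 ≤ t →
        X.expectedNumber k G y t ≠ ∞ ∧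
        HasDerivWithinAt (X.momentGen k G y t) (X.expectedNumber k G y t).toReal
          (X.momentGenDomain k G y t) 0 ∧
        Set.Iic 0 ⊆ X.momentGenDomain k G y t) ∧
    (∀ (G : Set (EuclideanSpace ℝ (Fin n))), MeasurableSet G →
      ∀ y : EuclideanSpace ℝ (Fin n), X.expectedNumber 0 G y 0 = Measure.dirac y G) ∧
    ∃ A : ℕ → EuclideanSpace ℝ (Fin n) → EuclideanSpace ℝ (Fin n) → ℝ → ℝ,
      -- first moment densities exist and are essentially unique
      X.IsFirstMomentDensity A ∧
      (∀ A' : ℕ → EuclideanSpace ℝ (Fin n) → EuclideanSpace ℝ (Fin n) → ℝ → ℝ,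
        X.IsFirstMomentDensity A' → ∀ (k : ℕ) (y : EuclideanSpace ℝ (Fin n)) (t : ℝ),
          0 ≤ t → (0 < t ∨ 1 ≤ k) →
            (fun x => A' k x y t) =ᵐ[volume] fun x => A k x y t) ∧
      -- they solve the recursive system, whose solution is unique
      (∀ y : EuclideanSpace ℝ (Fin n),
        SolvesMomentSystem D lam B y (fun k x t => A k x y t) ∧
        ∀ a : ℕ → EuclideanSpace ℝ (Fin n) → ℝ → ℝ, SolvesMomentSystem D lam B y a →
          ∀ (k : ℕ) (x : EuclideanSpace ℝ (Fin n)) (t : ℝ), 0 < t → a k x t = A k x y t) ∧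
      -- explicit solution
      ∀ (k : ℕ) (x y : EuclideanSpace ℝ (Fin n)) (t : ℝ), 0 < t →
        A k x y t = (lam * B * t) ^ k / (k.factorial : ℝ) * A 0 x y t ∧
        A k x y t = (lam * B) ^ k / ((k.factorial : ℝ) * (4 * Real.pi * D) ^ ((n : ℝ) / 2)) *
          t ^ ((k : ℝ) - (n : ℝ) / 2) *
          Real.exp (-lam * t - ‖x - y‖ ^ 2 / (4 * D * t)) := by
  have hfin : ∀ (k : ℕ) (G : Set (EuclideanSpace ℝ (Fin n))), MeasurableSet G →
      ∀ (y : EuclideanSpace ℝ (Fin n)) (t : ℝ), 0 ≤ t → X.expectedNumber k G y t ≠ ∞ := by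
    intro k G hG y t ht
    rw [X.expectedNumber_eq hlam hB k hG y ht]
    have hheat : X.heat t.toNNReal (fun w => G.indicator 1 (y + w)) ≤ 1 := by
      refine (lintegral_mono fun ω => Set.indicator_le_self' (fun _ _ => zero_le_one) _).trans ?_
      simp
    exact ENNReal.mul_ne_top (ENNReal.pow_ne_top ENNReal.ofReal_ne_top)
      (ENNReal.mul_ne_top ENNReal.ofReal_ne_top (ne_top_of_le_ne_top ENNReal.one_ne_top hheat))
  have hA := isFirstMomentDensity_momentDensity hD hlam hB X
  refine ⟨fun k G hG y t ht => ⟨hfin k G hG y t ht,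
      X.hasDerivWithinAt_momentGen k hG y t (hfin k G hG y t ht)⟩, fun G hG y => ?_,
    momentDensity D lam B, hA, fun A' hA' => hA'.ae_eq hA, fun y =>
      ⟨solvesMomentSystem_momentDensity hD hlam X y, fun a ha =>
        ha.eq_of_pos hD hlam (solvesMomentSystem_momentDensity hD hlam X y)⟩,
    fun k x y t ht => ⟨?_, momentDensity_eq_explicit hD lam B k x y ht⟩⟩
  · rw [X.expectedNumber_eq hlam hB 0 hG y le_rfl, Real.toNNReal_zero, X.heat_zero,
      Measure.dirac_apply' _ hG]
    simp
  · simp [momentDensity_of_pos D lam B _ x y ht]
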